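/- In the comparison model, an input is a list $I=(I[1],\dots,I[n])$ of elements of some totally ordered set; the only operation on its elements is to compare two of them, with answer $<$, $=$ or $>$. A deterministic comparison-based algorithm for element distinctness is given by one comparison (decision) tree for every $n$, and it must, on every list of $n$ elements of every totally ordered set, output two distinct positions holding equal elements, or report that no such pair exists. Let $\operatorname{runtime}(\mathcal A,I)$ be the number of comparisons that $\mathcal A$ performs on $I$. Let $G(I)$ be the graph on $\{1,\dots,n\}$ in which distinct $i,j$ are adjacent if and only if $I[i]=I[j]$, and let $\mathbb G_n$ be the set of $n$-vertex graphs all of whose connected components are cliques. For $G\in\mathbb G_n$ put $$\operatorname{Universal}(\mathcal A,G)=\max_{I:\,G(I)\cong G}\operatorname{runtime}(\mathcal A,I).$$ **Theorem.** There are a constant $c>0$ and a deterministic comparison-based algorithm $\mathcal A$ for element distinctness such that, for every $n$, every $G\in\mathbb G_n$ and every deterministic comparison-based algorithm $\mathcal A'$ for element distinctness, $$\operatorname{Universal}(\mathcal A,G)\le c\cdot\max\{1,\log\log n\}\cdot\operatorname{Universal}(\mathcal A',G).$$ Here $\log=\log_2$, and $\max\{1,\log\log n\}$ is read as $1$ when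 $n\le 2$. The algorithm $\mathcal A$ and the constant $c$ depend neither on $G$ nor on $\mathcal A'$. -/

import Mathlib

/-- Deterministic comparison-based procedures on `n` input elements, as comparison trees: a
procedure either stops with the report that all elements are distinct, or stops by naming a pair of
positions, or compares the elements at two positions and continues according to the answer
(`Ordering.lt`, `Ordering.eq` or `Ordering.gt`). -/
inductive ComparisonTree (n : ℕ) : Type
  | reportDistinct : ComparisonTree n
  | reportPair (i j : Fin n) : ComparisonTree n
  | compare (i j : Fin n) (next : Ordering → ComparisonTree n) : ComparisonTree n

namespace ComparisonTree

/-- The output on the input list `I`: `none` for "no duplicates", `some (i, j)` for a pair. -/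
def output {n : ℕ} {U : Type} [LinearOrder U] (I : Fin n → U) :
    ComparisonTree n → Option (Fin n × Fin n)
  | reportDistinct => none
  | reportPair i j => some (i, j)
  | compare i j next => output I (next (cmp (I i) (I j)))

/-- The number of comparisons performed on the input list `I`. -/
def runtime {n : ℕ} {U : Type} [LinearOrder U] (I : Fin n → U) : ComparisonTree n → ℕ
  | reportDistinct => 0
  | reportPair _ _ => 0
  | compare i j next => runtime I (next (cmp (I i) (I j))) + 1

/-- The largest number of comparisons on a root-to-leaf path of the tree. -/
def depth {n : ℕ} : ComparisonTree n → ℕ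
  | reportDistinct => 0
  | reportPair _ _ => 0
  | compare _ _ next =>
      max (depth (next .lt)) (max (depth (next .eq)) (depth (next .gt))) + 1

theorem runtime_le_depth {n : ℕ} {U : Type} [LinearOrder U] (I : Fin n → U)
    (T : ComparisonTree n) : T.runtime I ≤ T.depth := by
  induction T with
  | reportDistinct => simp [runtime]
  | reportPair i j => simp [runtime]
  | compare i j next ih =>
    have h := ih (cmp (I i) (I j))
    simp only [runtime, depth]
    cases hc : cmp (I i) (I j) <;> rw [hc] at h <;> omega

end ComparisonTree

/-- `o` is a correct answer to element distinctness on the list `I`: either a pair of equal elements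
at different positions, or the report `none` if there is no such pair. -/
def IsCorrectAnswer {n : ℕ} {U : Type} (I : Fin n → U) : Option (Fin n × Fin n) → Prop
  | none => ∀ i j : Fin n, i ≠ j → I i ≠ I j
  | some (i, j) => i ≠ j ∧ I i = I j

/-- A deterministic comparison-based algorithm for element distinctness: for every input length `n`
a comparison tree that answers correctly on every list of `n` elements of every totally ordered
set. -/
structure DistinctnessAlgorithm : Type where
  tree : (n : ℕ) → ComparisonTree n
  correct : ∀ (n : ℕ) (U : Type) [LinearOrder U] (I : Fin n → U),
    IsCorrectAnswer I ((tree n).output I)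

/-- The graph `G(I)`: distinct positions are adjacent iff they hold equal elements. -/
def duplicateGraph {n : ℕ} {U : Type} (I : Fin n → U) : SimpleGraph (Fin n) where
  Adj i j := i ≠ j ∧ I i = I j
  symm := ⟨fun _ _ h => ⟨h.1.symm, h.2.symm⟩⟩
  loopless := ⟨fun _ h => h.1 rfl⟩

/-- `G` is a disjoint union of cliques: every connected component is a clique. -/
def IsUnionOfCliques {n : ℕ} (G : SimpleGraph (Fin n)) : Prop :=
  ∀ c : G.ConnectedComponent, G.IsClique c.supp

/-- The set of all `runtime(A, I)` over the inputs `I`, from any totally ordered set, with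
`G(I) ≅ G`. -/
def runtimesOn (A : DistinctnessAlgorithm) {n : ℕ} (G : SimpleGraph (Fin n)) : Set ℕ :=
  {m | ∃ (U : Type) (_ : LinearOrder U) (I : Fin n → U),
    Nonempty (duplicateGraph I ≃g G) ∧ m = (A.tree n).runtime I}

/-- `Universal(A, G)`, the maximum of `runtime(A, I)` over all inputs `I` with `G(I) ≅ G`. -/
noncomputable def universalRuntime (A : DistinctnessAlgorithm) {n : ℕ}
    (G : SimpleGraph (Fin n)) : ℕ :=
  sSup (runtimesOn A G)

/-- For a union of cliques the supremum is a maximum over a nonempty bounded set. -/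
theorem universalRuntime_isGreatest (A : DistinctnessAlgorithm) {n : ℕ}
    (G : SimpleGraph (Fin n)) (hG : IsUnionOfCliques G) :
    IsGreatest (runtimesOn A G) (universalRuntime A G) := by
  have hne : (runtimesOn A G).Nonempty := by
    refine ⟨_, G.ConnectedComponent, by classical exact linearOrderOfSTO WellOrderingRel,
      G.connectedComponentMk, ⟨⟨Equiv.refl _, ?_⟩⟩, rfl⟩
    intro a b
    constructor
    · intro h
      exact ⟨h.ne, SimpleGraph.ConnectedComponent.sound h.reachable⟩
    · rintro ⟨hab, h⟩
      exact hG (G.connectedComponentMk b) h rfl hab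
  have hbd : BddAbove (runtimesOn A G) := by
    refine ⟨(A.tree n).depth, ?_⟩
    rintro m ⟨U, _, I, -, rfl⟩
    exact ComparisonTree.runtime_le_depth I _
  exact ⟨Nat.sSup_mem hne hbd, fun m hm => le_csSup hbd hm⟩

/-!
The algorithm works in rounds `b = 0, 1, 2, …`, round `b` costing `O(ℓ * 2 ^ b)` comparisons where
`ℓ` is about `log log n`. Two kinds of tests are run, and every answer "equal" ends the run.

* A prefix of `t` positions is sorted in groups of size `s`, for `t * log s ≤ 2 ^ b`, where `log s`
  is a power of two; apart from a geometric series of cheap ones, there are `O(ℓ)` such tests. If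
  nothing is found, then every value occurs at most `⌈t / s⌉` times in the prefix, which bounds `t`
  in terms of the class sizes (`PrefixBound`).
* As soon as `2 ^ b ≥ n`, the same is done for initial segments of the order instead of prefixes.
  Initial segments of all relevant sizes, up to a constant factor, are obtained by repeatedly
  splitting at a median of medians; there are `O(ℓ)` of them. A value occurs in an initial segment
  completely or not at all, so that finding nothing shows that many positions hold values of low
  multiplicity (`InitialSegmentBound`). This second test is needed, since an algorithm may exploit
  arithmetic properties of the class sizes: if all classes have two elements and `n / 2` is odd, the
  median splits a class.

Conversely, suppose that round `b` finds nothing on some input with graph `G`. An adversary keeps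
every element at a node of the infinite binary tree, and at every comparison pushes the two elements
into disjoint subtrees (`ComparisonTree.exists_adversary`). After `C` comparisons the total depth is
at most `2 * C`, no two elements have been shown equal, and elements at the same node may still be
declared equal. It remains to distribute the elements over the classes of `G` so that each class
fits below one node; then every correct algorithm performs at least `C` comparisons on some input
with graph `G`. For `C = 2 ^ b / 100` this is always possible:

* If `2 ^ b > 32 * n`, classes are served in decreasing order of size by any node that still has
  enough elements. Were there none, many elements would lie on nodes with few elements each, hence
  at large depth, against `InitialSegmentBound` (`packable_of_initialSegmentBound`).
* If `2 ^ b ≤ 32 * n`, the elements left at the root fill up the classes. The other elements are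
  packed greedily, shallow nodes first and into the largest classes, and the losses from rounding
  are controlled depth by depth through `PrefixBound` (`packable_of_prefixBound`).

If all elements are distinct, the nodes of the adversary must be distinct as well, which takes total
depth of order `n * log n` (`exists_runtime_ge_of_injective`).
-/

/-! ### The adversary -/

/-- Inputs of the adversary: a position in the infinite binary tree, refined by a natural number. -/
abbrev TreeValue : Type := List Bool ×ₗ ℕ

/-- `I` refines `v`: every element lies in the subtree below the node to which `v` confines it. -/
def Refines {n : ℕ} (v : Fin n → List Bool) (I : Fin n → TreeValue) : Prop :=
  ∀ u, v u <+: (ofLex (I u)).1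

theorem Refines.mono {n : ℕ} {v v' : Fin n → List Bool} {I : Fin n → TreeValue}
    (h : Refines v' I) (hv : ∀ u, v u <+: v' u) : Refines v I :=
  fun u => (hv u).trans (h u)

theorem List.append_false_lt_append_true {p x y : List Bool} (hx : p ++ [false] <+: x)
    (hy : p ++ [true] <+: y) : x < y := by
  obtain ⟨x', rfl⟩ := hx
  obtain ⟨y', rfl⟩ := hy
  induction p with
  | nil => exact List.Lex.rel (by decide)
  | cons a p ih => exact List.Lex.cons ih

theorem TreeValue.lt_of_separated {p : List Bool} {x y : TreeValue}
    (hx : p ++ [false] <+: (ofLex x).1) (hy : p ++ [true] <+: (ofLex y).1) : x < y :=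
  Prod.Lex.toLex_lt_toLex.2 (Or.inl (List.append_false_lt_append_true hx hy))

/-- Two nodes of the binary tree can be pushed down, by two levels in total, into the two subtrees
below a common node `p`. -/
theorem exists_separating_node (a b : List Bool) :
    ∃ a' b' p : List Bool, a <+: a' ∧ b <+: b' ∧
      a'.length + b'.length ≤ a.length + b.length + 2 ∧
      (p ++ [false] <+: a' ∧ p ++ [true] <+: b' ∨ p ++ [true] <+: a' ∧ p ++ [false] <+: b') := by
  induction a generalizing b with
  | nil =>
    cases b with
    | nil => exact ⟨[false], [true], [], by simp⟩
    | cons c b =>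
      refine ⟨[!c], c :: b, [], by simp, by simp, by simp; omega, ?_⟩
      cases c <;> simp
  | cons c a ih =>
    cases b with
    | nil =>
      refine ⟨c :: a, [!c], [], by simp, by simp, by simp, ?_⟩
      cases c <;> simp
    | cons c' b =>
      by_cases hcc : c = c'
      · subst hcc
        obtain ⟨a', b', p, ha, hb, hlen, h⟩ := ih b
        exact ⟨c :: a', c :: b', c :: p, by simpa, by simpa, by simp; omega, by simpa⟩
      · refine ⟨c :: a, c' :: b, [], by simp, by simp, by simp, ?_⟩
        cases c <;> cases c' <;> simp at hcc ⊢

/-- Two nodes of the binary tree can be pushed down, by two levels in total, so that the order of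
all elements below them is fixed. -/
theorem exists_separation (a b : List Bool) :
    ∃ a' b' : List Bool, a <+: a' ∧ b <+: b' ∧ a'.length + b'.length ≤ a.length + b.length + 2 ∧
      ∃ o : Ordering, ∀ x y : TreeValue, a' <+: (ofLex x).1 → b' <+: (ofLex y).1 →
        cmp x y = o := by
  obtain ⟨a', b', p, ha, hb, hlen, h | h⟩ := exists_separating_node a b
  · exact ⟨a', b', ha, hb, hlen, .lt, fun x y hx hy =>
      (TreeValue.lt_of_separated (h.1.trans hx) (h.2.trans hy)).cmp_eq_lt⟩
  · exact ⟨a', b', ha, hb, hlen, .gt, fun x y hx hy =>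
      (TreeValue.lt_of_separated (h.2.trans hy) (h.1.trans hx)).cmp_eq_gt⟩

/-- The adversary survives `C` comparisons: by pushing elements down, at the price of `2 * C` in total
depth, it ensures that either all refinements need at least `C` comparisons or they all lead to the
same output. -/
theorem ComparisonTree.exists_adversary {n : ℕ} (C : ℕ) (T : ComparisonTree n)
    (v : Fin n → List Bool) :
    ∃ v' : Fin n → List Bool, (∀ u, v u <+: v' u) ∧
      ∑ u, (v' u).length ≤ ∑ u, (v u).length + 2 * C ∧
      ((∀ I, Refines v' I → C ≤ T.runtime I) ∨ ∃ o, ∀ I, Refines v' I → T.output I = o) := by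
  induction C generalizing T v with
  | zero => exact ⟨v, fun _ => List.prefix_rfl, by simp, Or.inl (by simp)⟩
  | succ C ih =>
    cases T with
    | reportDistinct =>
      exact ⟨v, fun _ => List.prefix_rfl, by omega, Or.inr ⟨none, fun I _ => rfl⟩⟩
    | reportPair i j =>
      exact ⟨v, fun _ => List.prefix_rfl, by omega, Or.inr ⟨some (i, j), fun I _ => rfl⟩⟩
    | compare i j next =>
      obtain ⟨w, hvw, hw, o, ho⟩ : ∃ w : Fin n → List Bool, (∀ u, v u <+: w u) ∧
          ∑ u, (w u).length ≤ ∑ u, (v u).length + 2 ∧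
          ∃ o, ∀ I, Refines w I → cmp (I i) (I j) = o := by
        by_cases hij : i = j
        · subst hij
          exact ⟨v, fun _ => List.prefix_rfl, by omega, .eq, fun I _ => cmp_self_eq_eq _⟩
        · obtain ⟨a, b, ha, hb, hab, o, ho⟩ := exists_separation (v i) (v j)
          refine ⟨Function.update (Function.update v i a) j b, ?_, ?_, o, ?_⟩
          · intro u
            by_cases huj : u = j
            · subst huj; simpa
            · by_cases hui : u = i
              · subst hui; simpa [huj]
              · simp [huj, hui]
          · have hji : j ∈ Finset.univ.erase i := by simp [Ne.symm hij]
            rw [← Finset.add_sum_erase _ _ (Finset.mem_univ i), ← Finset.add_sum_erase _ _ hji,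
              ← Finset.add_sum_erase (a := i) _ (fun u => (v u).length) (Finset.mem_univ i),
              ← Finset.add_sum_erase _ (fun u => (v u).length) hji]
            have : ∑ u ∈ (Finset.univ.erase i).erase j,
                (Function.update (Function.update v i a) j b u).length =
                ∑ u ∈ (Finset.univ.erase i).erase j, (v u).length := by
              refine Finset.sum_congr rfl fun u hu => ?_
              simp only [Finset.mem_erase] at hu
              simp [hu.1, hu.2.1]
            rw [this]
            simp [hij]
            omega
          · intro I hI
            exact ho _ _ (by simpa [hij] using hI i) (by simpa using hI j)
      obtain ⟨v', hwv, hv', h⟩ := ih (next o) w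
      refine ⟨v', fun u => (hvw u).trans (hwv u), by omega, ?_⟩
      rcases h with h | ⟨p, hp⟩
      · left
        intro I hI
        have := h I hI
        rw [ComparisonTree.runtime, ho I (hI.mono hwv)]
        omega
      · right
        refine ⟨p, fun I hI => ?_⟩
        rw [ComparisonTree.output, ho I (hI.mono hwv)]
        exact hp I hI

/-! ### Distributing elements over classes of prescribed sizes -/

/-- Greedy distribution with exact sizes. If, for every class `c`, any set of elements that is at
least as large as `c` and all smaller classes together contains `size c` elements of one colour,
then the elements can be distributed exactly over monochromatic classes: serve the classes in
decreasing order of size. -/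
theorem exists_monochromatic_partition {α ι κ : Type*} [DecidableEq α] [DecidableEq ι]
    [DecidableEq κ] [Nonempty ι] (v : α → κ) (size : ι → ℕ) (s₀ : Finset ι)
    (H : ∀ c ∈ s₀, ∀ R : Finset α,
      ∑ b ∈ s₀ with size b < size c, size b + size c ≤ R.card →
        ∃ a, size c ≤ (R.filter (v · = a)).card)
    (R : Finset α) (hR : R.card = ∑ c ∈ s₀, size c) :
    ∃ g : α → ι, (∀ u ∈ R, g u ∈ s₀) ∧ (∀ c ∈ s₀, (R.filter (g · = c)).card = size c) ∧
      ∀ u ∈ R, ∀ u' ∈ R, g u = g u' → v u = v u' := by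
  suffices h : ∀ s : Finset ι, s ⊆ s₀ → (∀ a ∈ s₀, a ∉ s → ∀ b ∈ s, size b ≤ size a) →
      ∀ R : Finset α, R.card = ∑ c ∈ s, size c →
      ∃ g : α → ι, (∀ u ∈ R, g u ∈ s) ∧ (∀ c ∈ s, (R.filter (g · = c)).card = size c) ∧
        ∀ u ∈ R, ∀ u' ∈ R, g u = g u' → v u = v u' from
    h s₀ subset_rfl (fun a ha ha' => absurd ha ha') R hR
  intro s
  induction s using Finset.induction_on_max_value size with
  | empty =>
    intro _ _ R hR
    obtain rfl : R = ∅ := by simpa using hR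
    exact ⟨fun _ => Classical.arbitrary ι, by simp, by simp, by simp⟩
  | insert c s hcs hmax ih =>
    intro hs hup R hR
    rw [Finset.sum_insert hcs] at hR
    have hle : ∑ b ∈ s₀ with size b < size c, size b ≤ ∑ b ∈ s, size b := by
      refine Finset.sum_le_sum_of_subset fun b hb => ?_
      rw [Finset.mem_filter] at hb
      by_contra hbs
      have hbc : b ≠ c := by rintro rfl; exact absurd hb.2 (lt_irrefl _)
      exact absurd (hup b hb.1 (by simp [hbc, hbs]) c (by simp)) (not_le.2 hb.2)
    obtain ⟨a, ha⟩ := H c (hs (by simp)) R (by omega)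
    obtain ⟨E, hE, hEc⟩ := Finset.exists_subset_card_eq ha
    have hER : E ⊆ R := hE.trans (Finset.filter_subset _ _)
    obtain ⟨g, hg, hgc, hgv⟩ := ih ((Finset.subset_insert _ _).trans hs)
      (fun b hb hbs d hd => by
        by_cases hbc : b = c
        · subst hbc; exact hmax d hd
        · exact hup b hb (by simp [hbc, hbs]) d (by simp [hd]))
      (R \ E) (by rw [Finset.card_sdiff_of_subset hER]; omega)
    have hgne : ∀ u ∈ R, u ∉ E → g u ≠ c := fun u hu hu' h =>
      hcs (h ▸ hg u (by simp [hu, hu']))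
    refine ⟨fun u => if u ∈ E then c else g u, ?_, ?_, ?_⟩
    · intro u hu
      by_cases hu' : u ∈ E
      · simp [hu']
      · simp only [hu', if_false]
        exact Finset.mem_insert_of_mem (hg u (by simp [hu, hu']))
    · intro b hb
      rcases Finset.mem_insert.1 hb with rfl | hb
      · rw [← hEc]
        congr 1
        ext u
        by_cases hu' : u ∈ E
        · simp [hu', hER hu']
        · simp only [Finset.mem_filter, hu', if_false, iff_false, not_and]
          exact fun hu => hgne u hu hu'
      · rw [← hgc b hb]
        congr 1
        have hbc : c ≠ b := by rintro rfl; exact hcs hb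
        ext u
        by_cases hu' : u ∈ E <;> simp [hu', hbc]
    · intro u hu u' hu' h
      by_cases h1 : u ∈ E <;> by_cases h2 : u' ∈ E
      · rw [(Finset.mem_filter.1 (hE h1)).2, (Finset.mem_filter.1 (hE h2)).2]
      · simp only [h1, h2, if_true, if_false] at h
        exact absurd h.symm (hgne u' hu' h2)
      · simp only [h1, h2, if_true, if_false] at h
        exact absurd h (hgne u hu h1)
      · simp only [h1, h2, if_false] at h
        exact hgv u (by simp [hu, h1]) u' (by simp [hu', h2]) h

/-- Total capacity of the classes in `s` when at most `y` elements go to each class. -/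
def truncatedCapacity {ι : Type*} (size : ι → ℕ) (s : Finset ι) (y : ℕ) : ℕ :=
  ∑ c ∈ s, min (size c) y

/-- The largest classes hold a share of the truncated capacity that grows with the truncation. -/
theorem truncatedCapacity_mul_le {ι : Type*} [DecidableEq ι] (size : ι → ℕ) {U s : Finset ι}
    (hU : U ⊆ s) (hup : ∀ a ∈ U, ∀ b ∈ s \ U, size b ≤ size a) {y' y : ℕ} (hy : y' ≤ y) :
    truncatedCapacity size U y' * truncatedCapacity size s y ≤
      truncatedCapacity size U y * truncatedCapacity size s y' := by
  have key : truncatedCapacity size U y' * truncatedCapacity size (s \ U) y ≤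
      truncatedCapacity size U y * truncatedCapacity size (s \ U) y' := by
    unfold truncatedCapacity
    rw [Finset.sum_mul_sum, Finset.sum_mul_sum]
    refine Finset.sum_le_sum fun a ha => Finset.sum_le_sum fun b hb => ?_
    have hba := hup a ha b hb
    rcases le_total (size a) y' with h1 | h1
    · simp [min_eq_left h1, min_eq_left (h1.trans hy), min_eq_left (hba.trans h1),
        min_eq_left (hba.trans (h1.trans hy))]
    · rw [min_eq_right h1]
      rcases le_total (size b) y' with h2 | h2
      · rw [min_eq_left h2, min_eq_left (h2.trans hy)]
        exact Nat.mul_le_mul_right _ (le_min h1 hy)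
      · rw [min_eq_right h2, mul_comm]
        exact Nat.mul_le_mul_right _ (min_le_min_right _ hba)
  have hsplit : ∀ z, truncatedCapacity size s z =
      truncatedCapacity size (s \ U) z + truncatedCapacity size U z := fun z =>
    (Finset.sum_sdiff hU).symm
  rw [hsplit, hsplit, mul_add, mul_add, mul_comm (truncatedCapacity size U y')
    (truncatedCapacity size U y)]
  omega

/-- Greedy distribution with upper bounds on the sizes. Colours have depths, and the capacity
relevant at depth `d` is the one truncated at `y d`. The potential adds up the share of the capacity
already in use, the share needed for the elements of `R`, and the share that may be lost by rounding
up to whole classes, once for every colour; it does not increase when the largest remaining class is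
given to a colour of least depth. -/
theorem exists_monochromatic_packing {α ι κ : Type*} [DecidableEq α] [DecidableEq ι]
    [DecidableEq κ] [Nonempty ι] (v : α → κ) (depth : κ → ℕ) (size : ι → ℕ) (s₀ : Finset ι)
    (y : ℕ → ℕ) (hy : Antitone y) (hy1 : ∀ d, 1 ≤ y d)
    (hT : ∀ d, 0 < truncatedCapacity size s₀ (y d)) (R : Finset α)
    (hR : ∑ u ∈ R, (1 : ℝ) / truncatedCapacity size s₀ (y (depth (v u))) +
      ∑ a ∈ R.image v, ((y (depth a) : ℝ) - 1) / truncatedCapacity size s₀ (y (depth a)) ≤ 1) :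
    ∃ g : α → ι, (∀ u ∈ R, g u ∈ s₀) ∧ (∀ c ∈ s₀, (R.filter (g · = c)).card ≤ size c) ∧
      ∀ u ∈ R, ∀ u' ∈ R, g u = g u' → v u = v u' := by
  set T : ℕ → ℝ := fun d => truncatedCapacity size s₀ (y d) with hTdef
  have hTpos : ∀ d, 0 < T d := fun d => Nat.cast_pos.2 (hT d)
  suffices h : ∀ s : Finset ι, s ⊆ s₀ → (∀ a ∈ s₀, a ∉ s → ∀ b ∈ s, size b ≤ size a) →
      ∀ (R : Finset α) (d : ℕ), (∀ u ∈ R, d ≤ depth (v u)) →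
      truncatedCapacity size (s₀ \ s) (y d) / T d + (∑ u ∈ R, 1 / T (depth (v u)) +
        ∑ a ∈ R.image v, ((y (depth a) : ℝ) - 1) / T (depth a)) ≤ 1 →
      ∃ g : α → ι, (∀ u ∈ R, g u ∈ s) ∧ (∀ c ∈ s, (R.filter (g · = c)).card ≤ size c) ∧
        ∀ u ∈ R, ∀ u' ∈ R, g u = g u' → v u = v u' from
    h s₀ subset_rfl (fun a ha ha' => absurd ha ha') R 0 (by simp)
      (by
        have h0 : truncatedCapacity size (s₀ \ s₀) (y 0) = 0 := by simp [truncatedCapacity]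
        rw [h0, Nat.cast_zero, zero_div, zero_add]
        exact hR)
  have hwaste : ∀ d, 0 ≤ ((y d : ℝ) - 1) / T d := fun d =>
    div_nonneg (sub_nonneg.2 (by exact_mod_cast hy1 d)) (hTpos d).le
  clear hR R
  intro s
  induction s using Finset.induction_on_max_value size with
  | empty =>
    intro _ _ R d _ hR
    have h1 : (truncatedCapacity size (s₀ \ ∅) (y d) : ℝ) / T d = 1 := by
      rw [Finset.sdiff_empty]; exact div_self (hTpos d).ne'
    have h2 : 0 ≤ ∑ a ∈ R.image v, ((y (depth a) : ℝ) - 1) / T (depth a) :=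
      Finset.sum_nonneg fun a _ => hwaste _
    obtain rfl : R = ∅ := by
      by_contra hne
      have : 0 < ∑ u ∈ R, 1 / T (depth (v u)) :=
        Finset.sum_pos (fun u _ => one_div_pos.2 (hTpos _)) (Finset.nonempty_iff_ne_empty.2 hne)
      linarith
    exact ⟨fun _ => Classical.arbitrary ι, by simp, by simp, by simp⟩
  | insert c s hcs hmax ih =>
    intro hs hup R d hd hR
    rcases R.eq_empty_or_nonempty with rfl | hne
    · exact ⟨fun _ => c, by simp, by simp, by simp⟩
    obtain ⟨u₀, hu₀, hmin⟩ := R.exists_min_image (fun u => depth (v u)) hne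
    set E₀ := R.filter (v · = v u₀) with hE₀
    obtain ⟨E, hE, hEc⟩ := Finset.exists_subset_card_eq (min_le_left E₀.card (size c))
    have hER : E ⊆ R := hE.trans (Finset.filter_subset _ _)
    have hEv : ∀ u ∈ E, v u = v u₀ := fun u hu => (Finset.mem_filter.1 (hE hu)).2
    set d₀ := depth (v u₀) with hd₀
    -- The share in use does not increase when the reference depth goes up to `d₀`.
    have hmono : truncatedCapacity size (s₀ \ insert c s) (y d₀) / T d₀ ≤
        truncatedCapacity size (s₀ \ insert c s) (y d) / T d := by
      rw [div_le_div_iff₀ (hTpos _) (hTpos _)]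
      have := truncatedCapacity_mul_le size (U := s₀ \ insert c s) (s := s₀)
        Finset.sdiff_subset (fun a ha b hb => by
          rw [Finset.mem_sdiff] at ha
          refine hup a ha.1 ha.2 b ?_
          simp only [Finset.mem_sdiff, not_and, not_not] at hb
          exact hb.2 hb.1) (hy (hd u₀ hu₀))
      simp only [hTdef]
      exact_mod_cast this
    have hinsert : (truncatedCapacity size (s₀ \ s) (y d₀) : ℝ) =
        truncatedCapacity size (s₀ \ insert c s) (y d₀) + (min (size c) (y d₀) : ℕ) := by
      have hcs₀ : c ∈ s₀ \ s := by simp [hcs, hs (Finset.mem_insert_self c s)]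
      have : s₀ \ insert c s = (s₀ \ s).erase c := by
        ext x; simp only [Finset.mem_sdiff, Finset.mem_insert, Finset.mem_erase]; tauto
      rw [this]
      unfold truncatedCapacity
      rw [← Finset.sum_erase_add _ _ hcs₀]
      push_cast
      ring
    have hsumE : ∑ u ∈ R \ E, 1 / T (depth (v u)) + E.card / T d₀ =
        ∑ u ∈ R, 1 / T (depth (v u)) := by
      rw [← Finset.sum_sdiff hER]
      congr 1
      rw [Finset.sum_congr rfl (fun u hu => by rw [hEv u hu])]
      simp [hd₀, div_eq_mul_inv]
    have hstep : (min (size c) (y d₀) : ℕ) / T d₀ +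
        ∑ a ∈ (R \ E).image v, ((y (depth a) : ℝ) - 1) / T (depth a) ≤
        E.card / T d₀ + ∑ a ∈ R.image v, ((y (depth a) : ℝ) - 1) / T (depth a) := by
      have hv₀ : v u₀ ∈ R.image v := Finset.mem_image_of_mem v hu₀
      rcases le_or_gt E₀.card (size c) with hle | hlt
      · -- All elements of this colour are served, and the colour is done.
        rw [min_eq_left hle] at hEc
        have hEE : E = E₀ := Finset.eq_of_subset_of_card_le hE hEc.ge
        have hsub : (R \ E).image v ⊆ (R.image v).erase (v u₀) := by
          intro a ha
          obtain ⟨u, hu, rfl⟩ := Finset.mem_image.1 ha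
          rw [Finset.mem_sdiff] at hu
          refine Finset.mem_erase.2 ⟨fun h => hu.2 ?_, Finset.mem_image_of_mem v hu.1⟩
          rw [hEE, hE₀]
          exact Finset.mem_filter.2 ⟨hu.1, h⟩
        have h1 : ∑ a ∈ (R \ E).image v, ((y (depth a) : ℝ) - 1) / T (depth a) ≤
            ∑ a ∈ (R.image v).erase (v u₀), ((y (depth a) : ℝ) - 1) / T (depth a) :=
          Finset.sum_le_sum_of_subset_of_nonneg hsub fun a _ _ => hwaste _
        have hpos : 0 < E.card := by
          rw [hEE]; exact Finset.card_pos.2 ⟨u₀, by simp [hE₀, hu₀]⟩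
        have h2 : ((min (size c) (y d₀) : ℕ) : ℝ) / T d₀ ≤
            E.card / T d₀ + ((y d₀ : ℝ) - 1) / T d₀ := by
          rw [← add_div]
          refine div_le_div_of_nonneg_right ?_ (hTpos _).le
          have h3 : ((min (size c) (y d₀) : ℕ) : ℝ) ≤ y d₀ := by exact_mod_cast min_le_right _ _
          have h4 : (1 : ℝ) ≤ E.card := by exact_mod_cast hpos
          linarith
        rw [← Finset.add_sum_erase _ _ hv₀]
        linarith
      · rw [min_eq_right hlt.le] at hEc
        have h1 : ∑ a ∈ (R \ E).image v, ((y (depth a) : ℝ) - 1) / T (depth a) ≤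
            ∑ a ∈ R.image v, ((y (depth a) : ℝ) - 1) / T (depth a) :=
          Finset.sum_le_sum_of_subset_of_nonneg (Finset.image_subset_image Finset.sdiff_subset)
            fun a _ _ => hwaste _
        have h2 : ((min (size c) (y d₀) : ℕ) : ℝ) / T d₀ ≤ E.card / T d₀ := by
          refine div_le_div_of_nonneg_right ?_ (hTpos _).le
          rw [hEc]; exact_mod_cast min_le_left _ _
        linarith
    obtain ⟨g, hg, hgc, hgv⟩ := ih ((Finset.subset_insert _ _).trans hs)
      (fun b hb hbs e he => by
        by_cases hbc : b = c
        · subst hbc; exact hmax e he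
        · exact hup b hb (by simp [hbc, hbs]) e (by simp [he]))
      (R \ E) d₀ (fun u hu => hmin u (Finset.mem_sdiff.1 hu).1) (by
        rw [hinsert, add_div]
        linarith)
    have hgne : ∀ u ∈ R, u ∉ E → g u ≠ c := fun u hu hu' h =>
      hcs (h ▸ hg u (by simp [hu, hu']))
    refine ⟨fun u => if u ∈ E then c else g u, ?_, ?_, ?_⟩
    · intro u hu
      by_cases hu' : u ∈ E
      · simp [hu']
      · simp only [hu', if_false]
        exact Finset.mem_insert_of_mem (hg u (by simp [hu, hu']))
    · intro b hb
      rcases Finset.mem_insert.1 hb with rfl | hb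
      · refine le_trans (Finset.card_le_card (t := E) fun u hu => ?_)
          (hEc.trans_le (min_le_right _ _))
        rw [Finset.mem_filter] at hu
        by_contra hu'
        simp only [hu', if_false] at hu
        exact hgne u hu.1 hu' hu.2
      · refine le_trans (Finset.card_le_card fun u hu => ?_) (hgc b hb)
        have hbc : c ≠ b := by rintro rfl; exact hcs hb
        rw [Finset.mem_filter] at hu ⊢
        by_cases hu' : u ∈ E
        · simp [hu', hbc] at hu
        · simpa [hu'] using hu
    · intro u hu u' hu' h
      by_cases h1 : u ∈ E <;> by_cases h2 : u' ∈ E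
      · rw [hEv u h1, hEv u' h2]
      · simp only [h1, h2, if_true, if_false] at h
        exact absurd h.symm (hgne u' hu' h2)
      · simp only [h1, h2, if_true, if_false] at h
        exact absurd h (hgne u hu h1)
      · simp only [h1, h2, if_false] at h
        exact hgv u (by simp [hu, h1]) u' (by simp [hu', h2]) h

/-- A partial distribution respecting upper bounds on the sizes extends to an exact one. -/
theorem exists_extension_of_fiber_card_le {α ι : Type*} [Fintype α] [DecidableEq α]
    [DecidableEq ι] [Nonempty ι] (size : ι → ℕ) (s : Finset ι)
    (hsize : ∑ c ∈ s, size c = Fintype.card α) (R : Finset α) (g : α → ι)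
    (hgs : ∀ u ∈ R, g u ∈ s) (hg : ∀ c ∈ s, (R.filter (g · = c)).card ≤ size c) :
    ∃ g' : α → ι, (∀ u ∈ R, g' u = g u) ∧ (∀ u, g' u ∈ s) ∧
      ∀ c ∈ s, (Finset.univ.filter (g' · = c)).card = size c := by
  have hRsum : ∑ c ∈ s, (R.filter (g · = c)).card = R.card :=
    (Finset.card_eq_sum_card_fiberwise hgs).symm
  have hrest : (Rᶜ).card = ∑ c ∈ s, (size c - (R.filter (g · = c)).card) := by
    rw [Finset.sum_tsub_distrib _ hg, hRsum, hsize, Finset.card_compl]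
  obtain ⟨h, hhs, hh, -⟩ := exists_monochromatic_partition (fun _ : α => ())
    (fun c => size c - (R.filter (g · = c)).card) s (fun c hc R' hR' => ⟨(), by simp; omega⟩)
    Rᶜ hrest
  refine ⟨fun u => if u ∈ R then g u else h u, fun u hu => by simp [hu], fun u => ?_,
    fun c hc => ?_⟩
  · by_cases hu : u ∈ R
    · simp [hu, hgs u hu]
    · simp [hu, hhs u (by simp [hu])]
  · have hsplit : Finset.univ.filter (fun u => (if u ∈ R then g u else h u) = c) =
        R.filter (g · = c) ∪ Rᶜ.filter (h · = c) := by
      ext u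
      by_cases hu : u ∈ R <;> simp [hu]
    rw [hsplit, Finset.card_union_of_disjoint, hh c hc, Nat.add_sub_cancel' (hg c hc)]
    exact Finset.disjoint_filter_filter disjoint_compl_right

/-! ### Fitting the nodes of the adversary into the classes of equal elements -/

/-- The number of positions holding the value `x`. -/
def valueCount {n : ℕ} (I : Fin n → ℕ) (x : ℕ) : ℕ := (Finset.univ.filter (I · = x)).card

/-- The largest size of a set of positions in which no value occurs more than `y` times. -/
def cappedSize {n : ℕ} (I : Fin n → ℕ) (y : ℕ) : ℕ :=
  truncatedCapacity (valueCount I) (Finset.univ.image I) y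

/-- The number of positions whose value occurs at most `z` times. -/
def rareSize {n : ℕ} (I : Fin n → ℕ) (z : ℕ) : ℕ :=
  ∑ x ∈ Finset.univ.image I with valueCount I x ≤ z, valueCount I x

/-- The elements can be redistributed over classes of the same sizes as in `I₀` so that each class
fits into the subtree of a single node, compatibly with the nodes prescribed by `v`. -/
def Packable {n : ℕ} (I₀ : Fin n → ℕ) (v : Fin n → List Bool) : Prop :=
  ∃ (g : Fin n → ℕ) (node : ℕ → List Bool), (∀ x, valueCount g x = valueCount I₀ x) ∧
    ∀ u, v u <+: node (g u)

/-- What sorting prefixes in groups tells about an input without showing equal elements: the prefix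
of length `2 ^ i` has been sorted in groups of size `2 ^ 2 ^ min (b - i) ℓ`, so that each of its
values occurs at most once in each group. -/
def PrefixBound {n : ℕ} (I : Fin n → ℕ) (b ℓ : ℕ) : Prop :=
  ∀ i ≤ b, ∀ w, min n (2 ^ i) ≤ w * 2 ^ 2 ^ min (b - i) ℓ → min n (2 ^ i) ≤ cappedSize I w

/-- What sorting initial segments of the order in groups tells about an input without showing equal
elements. An initial segment of `m` elements, for `m` within a factor `8` of any `t ≥ θ`, contains
every value completely or not at all, and each of its values occurs at most once in each group; the
groups have size `2 ^ k`, where `k = 2 ^ b / m` unless this exceeds `2 ^ ℓ`. -/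
def InitialSegmentBound {n : ℕ} (I : Fin n → ℕ) (b ℓ θ : ℕ) : Prop :=
  n ≤ 2 ^ b → ∀ t ≤ n, ∃ m, t ≤ m ∧ m ≤ n ∧ m ≤ 8 * max t θ ∧
    ∀ w, m ≤ w * 2 ^ min (2 ^ b / m) (2 ^ ℓ) → m ≤ rareSize I w

theorem sum_valueCount {n : ℕ} (I : Fin n → ℕ) :
    ∑ x ∈ Finset.univ.image I, valueCount I x = n := by
  have := Finset.card_eq_sum_card_image I Finset.univ
  simpa [valueCount] using this.symm

theorem valueCount_pos {n : ℕ} {I : Fin n → ℕ} {x : ℕ} (hx : x ∈ Finset.univ.image I) :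
    0 < valueCount I x := by
  obtain ⟨u, -, rfl⟩ := Finset.mem_image.1 hx
  exact Finset.card_pos.2 ⟨u, by simp⟩

theorem valueCount_eq_of_forall_mem {n : ℕ} {I g : Fin n → ℕ}
    (hg : ∀ u, g u ∈ Finset.univ.image I)
    (h : ∀ x ∈ Finset.univ.image I, valueCount g x = valueCount I x) (x : ℕ) :
    valueCount g x = valueCount I x := by
  by_cases hx : x ∈ Finset.univ.image I
  · exact h x hx
  · have h1 : valueCount g x = 0 :=
      Finset.card_eq_zero.2 (Finset.filter_eq_empty_iff.2 fun u _ hu => hx (hu ▸ hg u))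
    have h2 : valueCount I x = 0 :=
      Finset.card_eq_zero.2 (Finset.filter_eq_empty_iff.2 fun u _ hu =>
        hx (hu ▸ Finset.mem_image_of_mem I (Finset.mem_univ u)))
    rw [h1, h2]

theorem card_le_two_pow_of_forall_length_eq {F : Finset (List Bool)} {d : ℕ}
    (hF : ∀ a ∈ F, a.length = d) : F.card ≤ 2 ^ d := by
  have : F ⊆ (Finset.univ : Finset (Fin d → Bool)).image List.ofFn := by
    intro a ha
    obtain rfl := hF a ha
    exact Finset.mem_image.2 ⟨a.get, Finset.mem_univ _, List.ofFn_get a⟩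
  refine (Finset.card_le_card this).trans (Finset.card_image_le.trans ?_)
  simp

theorem card_le_two_pow_of_forall_length_lt {F : Finset (List Bool)} {d : ℕ}
    (hF : ∀ a ∈ F, a.length < d) : F.card ≤ 2 ^ d := by
  rw [Finset.card_eq_sum_card_fiberwise (f := List.length) (t := Finset.range d)
    (fun a ha => by simpa using hF a ha)]
  refine (Finset.sum_le_sum (g := fun i => 2 ^ i) fun i _ =>
    card_le_two_pow_of_forall_length_eq (by simp)).trans ?_
  rw [Nat.geomSum_eq le_rfl]
  simp

theorem sum_one_div_sixteen_pow_length_le {F : Finset (List Bool)} (hF : ∀ a ∈ F, a ≠ []) :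
    ∑ a ∈ F, (1 / 16 : ℝ) ^ a.length ≤ 1 / 7 := by
  obtain ⟨N, hN⟩ : ∃ N, ∀ a ∈ F, a.length < N :=
    ⟨F.sup List.length + 1, fun a ha => Nat.lt_succ_of_le (Finset.le_sup (f := List.length) ha)⟩
  have hmaps : ∀ a ∈ F, a.length ∈ Finset.Ico 1 N := fun a ha =>
    Finset.mem_Ico.2 ⟨List.length_pos_iff.2 (hF a ha), hN a ha⟩
  rw [← Finset.sum_fiberwise_of_maps_to hmaps]
  have h1 : ∀ d ∈ Finset.Ico 1 N, ∑ a ∈ F with a.length = d, (1 / 16 : ℝ) ^ a.length ≤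
      (1 / 8 : ℝ) ^ d := by
    intro d _
    rw [Finset.sum_congr rfl (g := fun _ => (1 / 16 : ℝ) ^ d)
      (fun a ha => by rw [(Finset.mem_filter.1 ha).2]), Finset.sum_const, nsmul_eq_mul]
    have h2 : ((F.filter (fun a => a.length = d)).card : ℝ) ≤ 2 ^ d := by
      exact_mod_cast card_le_two_pow_of_forall_length_eq (by simp)
    calc _ ≤ (2 : ℝ) ^ d * (1 / 16) ^ d := by gcongr
      _ = (1 / 8) ^ d := by rw [← mul_pow]; norm_num
  refine (Finset.sum_le_sum h1).trans ?_
  refine (geom_sum_Ico_le_of_lt_one (by norm_num) (by norm_num)).trans ?_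
  norm_num

theorem card_filter_length_ge_mul_le {n : ℕ} (v : Fin n → List Bool) (R : Finset (Fin n))
    (d : ℕ) : (R.filter (fun u => d ≤ (v u).length)).card * d ≤ ∑ u, (v u).length := by
  calc _ = ∑ u ∈ R with d ≤ (v u).length, d := by simp
    _ ≤ ∑ u ∈ R with d ≤ (v u).length, (v u).length :=
        Finset.sum_le_sum fun u hu => (Finset.mem_filter.1 hu).2
    _ ≤ ∑ u, (v u).length := Finset.sum_le_sum_of_subset (Finset.subset_univ _)

/-- If every node holds at most `w` elements of `R`, then few elements of `R` are shallow. -/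
theorem card_filter_length_lt_le {n : ℕ} (v : Fin n → List Bool) (R : Finset (Fin n)) (w d : ℕ)
    (hw : ∀ a, (R.filter (v · = a)).card ≤ w) :
    (R.filter (fun u => (v u).length < d)).card ≤ w * 2 ^ d := by
  refine (Finset.card_le_mul_card_image (f := v) _ w fun a _ => ?_).trans
    (Nat.mul_le_mul_left _ (card_le_two_pow_of_forall_length_lt ?_))
  · exact (Finset.card_le_card
      (Finset.filter_subset_filter _ (Finset.filter_subset _ _))).trans (hw a)
  · intro a ha
    obtain ⟨u, hu, rfl⟩ := Finset.mem_image.1 ha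
    exact (Finset.mem_filter.1 hu).2

/-- Large budgets: the classes are filled exactly. A failure at a class of size `w + 1` would leave
more than `rareSize I₀ w` elements at nodes with at most `w` elements each, so that most of them
would have large depth. -/
theorem packable_of_initialSegmentBound {n b ℓ θ C : ℕ} {I₀ : Fin n → ℕ}
    (hI : InitialSegmentBound I₀ b ℓ θ) (hb : 32 * n < 2 ^ b) (hℓ : n ≤ 2 ^ 2 ^ ℓ)
    (hθ : θ * 2 ^ ℓ ≤ 4 * n) (hC : 100 * C ≤ 2 ^ b) (v : Fin n → List Bool)
    (hv : ∑ u, (v u).length ≤ 2 * C) : Packable I₀ v := by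
  have H : ∀ c ∈ Finset.univ.image I₀, ∀ R : Finset (Fin n),
      ∑ x ∈ Finset.univ.image I₀ with valueCount I₀ x < valueCount I₀ c, valueCount I₀ x +
        valueCount I₀ c ≤ R.card → ∃ a, valueCount I₀ c ≤ (R.filter (v · = a)).card := by
    intro c hc R hR
    by_contra! hsmall
    obtain ⟨w, hw⟩ := Nat.exists_eq_succ_of_ne_zero (valueCount_pos hc).ne'
    simp only [hw] at hR hsmall
    replace hsmall : ∀ a, (R.filter (v · = a)).card ≤ w := fun a => Nat.lt_succ_iff.1 (hsmall a)
    have hrare : ∑ x ∈ Finset.univ.image I₀ with valueCount I₀ x < w.succ, valueCount I₀ x =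
        rareSize I₀ w := by simp [rareSize]
    rw [hrare] at hR
    have hRn : R.card ≤ n := by simpa using R.card_le_univ
    have hw0 : 1 ≤ w := by
      by_contra! hw0
      obtain ⟨u, hu⟩ := Finset.card_pos.1 (show 0 < R.card by omega)
      have : 0 < (R.filter (v · = v u)).card := Finset.card_pos.2 ⟨u, by simp [hu]⟩
      have := hsmall (v u)
      omega
    obtain ⟨m, htm, hmn, hmt, hm⟩ := hI (by omega) (rareSize I₀ w + 1) (by omega)
    set t := rareSize I₀ w + 1 with ht
    have hmw : w * 2 ^ min (2 ^ b / m) (2 ^ ℓ) < m := by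
      by_contra! hcon
      have := hm w hcon
      omega
    have hk : 2 ^ b / m < 2 ^ ℓ := by
      by_contra! hcon
      rw [min_eq_right hcon] at hmw
      have : 1 * 2 ^ 2 ^ ℓ ≤ w * 2 ^ 2 ^ ℓ := Nat.mul_le_mul_right _ hw0
      omega
    rw [min_eq_left hk.le] at hmw
    have hmpos : 0 < m := by omega
    have hθt : θ ≤ t := by
      by_contra! hcon
      rw [max_eq_right hcon.le] at hmt
      refine absurd hk (not_lt.2 ((Nat.le_div_iff_mul_le hmpos).2 ?_))
      calc 2 ^ ℓ * m ≤ 2 ^ ℓ * (8 * θ) := Nat.mul_le_mul_left _ hmt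
        _ = 8 * (θ * 2 ^ ℓ) := by ring
        _ ≤ 2 ^ b := by omega
    rw [max_eq_left hθt] at hmt
    set k := 2 ^ b / m with hkdef
    have hk32 : 32 ≤ k := (Nat.le_div_iff_mul_le hmpos).2 (by omega)
    have hbk : 2 ^ b < m * (k + 1) := Nat.lt_mul_div_succ _ hmpos
    obtain ⟨d, hd⟩ : ∃ d, d = k / 2 := ⟨_, rfl⟩
    have hd16 : 16 ≤ d := by omega
    have h1 := card_filter_length_lt_le v R w d hsmall
    have h2 := (card_filter_length_ge_mul_le v R d).trans hv
    have h3 := Finset.card_filter_add_card_filter_not (s := R) (fun u => (v u).length < d)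
    simp only [not_lt] at h3
    have h4 : 32 * (w * 2 ^ d) ≤ t := by
      have : 2 ^ 16 * (w * 2 ^ d) ≤ w * 2 ^ k := by
        calc 2 ^ 16 * (w * 2 ^ d) ≤ 2 ^ d * (w * 2 ^ d) :=
              Nat.mul_le_mul_right _ (Nat.pow_le_pow_right (by norm_num) hd16)
          _ = w * 2 ^ (d + d) := by rw [pow_add]; ring
          _ ≤ w * 2 ^ k := Nat.mul_le_mul_left _ (Nat.pow_le_pow_right (by norm_num) (by omega))
      omega
    have h5 : 50 * (R.filter (fun u => d ≤ (v u).length)).card < 24 * t := by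
      have h6 : m * (k + 1) ≤ 8 * t * (3 * d) := Nat.mul_le_mul hmt (by omega)
      refine lt_of_mul_lt_mul_right (a := d) ?_ (Nat.zero_le d)
      calc 50 * (R.filter (fun u => d ≤ (v u).length)).card * d
          = 50 * ((R.filter (fun u => d ≤ (v u).length)).card * d) := by ring
        _ ≤ 100 * C := by omega
        _ < 8 * t * (3 * d) := by omega
        _ = 24 * t * d := by ring
    omega
  obtain ⟨g, hgs, hgc, hgv⟩ := exists_monochromatic_partition v (valueCount I₀)
    (Finset.univ.image I₀) H Finset.univ (by simp [sum_valueCount])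
  refine ⟨g, fun x => if h : ∃ u, g u = x then v h.choose else [],
    valueCount_eq_of_forall_mem (fun u => hgs u (Finset.mem_univ u)) hgc, fun u => ?_⟩
  have hex : ∃ u', g u' = g u := ⟨u, rfl⟩
  beta_reduce
  rw [dif_pos hex, hgv _ (Finset.mem_univ hex.choose) u (Finset.mem_univ u) hex.choose_spec]

/-- Small budgets: the elements that the adversary leaves at the root fill up the classes. -/
theorem packable_of_prefixBound {n b ℓ C : ℕ} {I₀ : Fin n → ℕ} (hn : 0 < n)
    (hI : PrefixBound I₀ b ℓ) (hb : 2 ^ b ≤ 32 * n) (hℓ : n ≤ 2 ^ 2 ^ ℓ)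
    (hC : 100 * C ≤ 2 ^ b) (v : Fin n → List Bool)
    (hv : ∑ u, (v u).length ≤ 2 * C) : Packable I₀ v := by
  set T := cappedSize I₀ with hT
  have hTmono : Monotone T := by
    intro z z' h
    rw [hT]
    unfold cappedSize truncatedCapacity
    gcongr
  have hTle : ∀ y, T y ≤ n := fun y =>
    (Finset.sum_le_sum fun x _ => min_le_left _ _).trans_eq (sum_valueCount I₀)
  have hTpos : ∀ y, 1 ≤ y → 1 ≤ T y := by
    intro y hy
    have hmem : I₀ ⟨0, hn⟩ ∈ Finset.univ.image I₀ := Finset.mem_image_of_mem _ (Finset.mem_univ _)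
    refine le_trans (le_min (valueCount_pos hmem) hy)
      (Finset.single_le_sum (f := fun x => min (valueCount I₀ x) y)
        (fun _ _ => Nat.zero_le _) hmem)
  -- The largest truncation for which rounding up costs at most a share `16 ^ (-d)`.
  set y : ℕ → ℕ := fun d => Nat.findGreatest (fun y => (y - 1) * 16 ^ d ≤ T y) (n + 1) with hy
  have hyspec : ∀ d, (y d - 1) * 16 ^ d ≤ T (y d) := fun d =>
    Nat.findGreatest_spec (P := fun y => (y - 1) * 16 ^ d ≤ T y) (m := 1) (by omega) (by simp)
  have hy1 : ∀ d, 1 ≤ y d := fun d => Nat.le_findGreatest (by omega) (by simp)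
  have hyanti : Antitone y := by
    intro d d' hdd
    refine Nat.findGreatest_mono_left (fun z hz => le_trans ?_ hz) _
    exact Nat.mul_le_mul_left _ (Nat.pow_le_pow_right (by norm_num) hdd)
  have hygt : ∀ d, T (y d) < y d * 16 ^ d := by
    intro d
    rcases Nat.lt_or_ge n (y d) with h | h
    · have h1 : 1 ≤ 16 ^ d := Nat.one_le_pow _ _ (by norm_num)
      have := hTle (y d)
      nlinarith
    · have := Nat.findGreatest_is_greatest (P := fun y => (y - 1) * 16 ^ d ≤ T y) (n := n + 1)
        (k := y d + 1) (Nat.lt_succ_self _) (by omega)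
      simp only [Nat.add_sub_cancel, not_le] at this
      exact (hTmono (Nat.le_succ _)).trans_lt this
  have hbudget : ∀ d, 1 ≤ d → 2 ^ b ≤ 32 * d * T (y d) := by
    intro d hd
    by_contra! hlt
    have hT1 := hTpos _ (hy1 d)
    have hTn : T (y d) < n := by
      by_contra! hcon
      nlinarith
    obtain ⟨j, hj⟩ : ∃ j, j = Nat.log 2 (T (y d)) := ⟨_, rfl⟩
    have hj1 : 2 ^ j ≤ T (y d) := hj ▸ Nat.pow_log_le_self 2 (by omega)
    have hj2 : T (y d) < 2 ^ (j + 1) := hj ▸ Nat.lt_pow_succ_log_self (by norm_num) _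
    have hdT : T (y d) ≤ d * T (y d) := Nat.le_mul_of_pos_left _ hd
    have hjb : j + 1 < b := by
      refine (Nat.pow_lt_pow_iff_right (a := 2) (by norm_num)).1 ?_
      rw [pow_succ]
      nlinarith
    have h : _ → min n (2 ^ (j + 1)) ≤ T (y d) := hI (j + 1) hjb.le (y d)
    refine absurd (h ?_) (not_le.2 ?_)
    rotate_left
    · have : T (y d) < min n (2 ^ (j + 1)) := lt_min hTn hj2
      exact this
    · rcases le_total ℓ (b - (j + 1)) with hle | hle
      · rw [min_eq_right hle]
        calc min n (2 ^ (j + 1)) ≤ n := min_le_left _ _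
          _ ≤ 1 * 2 ^ 2 ^ ℓ := by omega
          _ ≤ _ := Nat.mul_le_mul_right _ (hy1 d)
      · rw [min_eq_left hle]
        -- The group size exponent `2 ^ (b - (j + 1))` is at least `16 d ≥ 4 d + 1`.
        have h16 : 16 * d < 2 ^ (b - (j + 1)) := by
          refine lt_of_mul_lt_mul_right (a := 2 ^ (j + 1)) ?_ (Nat.zero_le _)
          rw [← pow_add, Nat.sub_add_cancel hjb.le, pow_succ]
          nlinarith
        calc min n (2 ^ (j + 1)) ≤ 2 * T (y d) := (min_le_right _ _).trans (by rw [pow_succ]; omega)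
          _ ≤ y d * (2 * 16 ^ d) := by have := hygt d; linarith
          _ = y d * 2 ^ (4 * d + 1) := by rw [pow_succ, pow_mul]; norm_num [mul_comm]
          _ ≤ _ := Nat.mul_le_mul_left _ (Nat.pow_le_pow_right (by norm_num) (by omega))
  set R : Finset (Fin n) := Finset.univ.filter (fun u => v u ≠ []) with hRdef
  have hpot : ∑ u ∈ R, (1 : ℝ) / T (y (v u).length) +
      ∑ a ∈ R.image v, ((y a.length : ℝ) - 1) / T (y a.length) ≤ 1 := by
    have hTR : ∀ d, (0 : ℝ) < T (y d) := fun d => by exact_mod_cast hTpos _ (hy1 d)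
    have hbR : (0 : ℝ) < 2 ^ b := by positivity
    have h1 : ∑ u ∈ R, (1 : ℝ) / T (y (v u).length) ≤ 16 / 25 := by
      calc ∑ u ∈ R, (1 : ℝ) / T (y (v u).length)
          ≤ ∑ u ∈ R, 32 / 2 ^ b * ((v u).length : ℝ) := by
            refine Finset.sum_le_sum fun u hu => ?_
            have hlen : 1 ≤ (v u).length := List.length_pos_iff.2 (Finset.mem_filter.1 hu).2
            rw [div_mul_eq_mul_div, div_le_div_iff₀ (hTR _) hbR, one_mul]
            exact_mod_cast hbudget _ hlen
        _ = 32 / 2 ^ b * ∑ u ∈ R, ((v u).length : ℝ) := by rw [Finset.mul_sum]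
        _ ≤ 32 / 2 ^ b * (2 * C) := by
            gcongr
            exact_mod_cast (Finset.sum_le_sum_of_subset (Finset.subset_univ R)).trans hv
        _ ≤ 16 / 25 := by
            have : (100 : ℝ) * C ≤ 2 ^ b := by exact_mod_cast hC
            rw [div_mul_eq_mul_div, div_le_div_iff₀ hbR (by norm_num)]
            linarith
    have h2 : ∑ a ∈ R.image v, ((y a.length : ℝ) - 1) / T (y a.length) ≤ 1 / 7 := by
      refine le_trans (Finset.sum_le_sum fun a _ => ?_) (sum_one_div_sixteen_pow_length_le
        (F := R.image v) fun a ha => ?_)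
      · rw [div_pow, one_pow, div_le_div_iff₀ (hTR _) (by positivity), one_mul]
        have := hyspec a.length
        have h3 : ((y a.length - 1 : ℕ) : ℝ) = (y a.length : ℝ) - 1 := by
          rw [Nat.cast_sub (hy1 _), Nat.cast_one]
        rw [← h3]
        exact_mod_cast this
      · obtain ⟨u, hu, rfl⟩ := Finset.mem_image.1 ha
        exact (Finset.mem_filter.1 hu).2
    -- The two contributions, from elements and from rounding, fit: `16 / 25 + 1 / 7 ≤ 1`.
    linarith
  obtain ⟨g, hgs, hgc, hgv⟩ := exists_monochromatic_packing v List.length (valueCount I₀)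
    (Finset.univ.image I₀) y hyanti hy1 (fun d => hTpos _ (hy1 d)) R hpot
  obtain ⟨g', hg'g, hg's, hg'c⟩ := exists_extension_of_fiber_card_le (valueCount I₀)
    (Finset.univ.image I₀) (by simp [sum_valueCount]) R g hgs hgc
  refine ⟨g', fun x => if h : ∃ u ∈ R, g u = x then v h.choose else [],
    valueCount_eq_of_forall_mem hg's hg'c, fun u => ?_⟩
  by_cases hu : u ∈ R
  · have hex : ∃ u' ∈ R, g u' = g u := ⟨u, hu, rfl⟩
    beta_reduce
    rw [hg'g u hu, dif_pos hex, hgv _ hex.choose_spec.1 u hu hex.choose_spec.2]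
  · have : v u = [] := by simpa [hRdef] using hu
    rw [this]
    exact List.nil_prefix

/-! ### The lower bound for every correct algorithm -/

theorem duplicateGraph_iso_of_valueCount_eq {n : ℕ} {g I₀ : Fin n → ℕ}
    (h : ∀ x, valueCount g x = valueCount I₀ x) :
    Nonempty (duplicateGraph g ≃g duplicateGraph I₀) := by
  have hcard : ∀ x, Nonempty ({u // g u = x} ≃ {u // I₀ u = x}) := fun x =>
    ⟨Fintype.equivOfCardEq (by rw [Fintype.card_subtype, Fintype.card_subtype]; exact h x)⟩
  have e := fun x => (hcard x).some
  refine ⟨⟨Equiv.ofFiberEquiv e, ?_⟩⟩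
  intro a b
  simp only [duplicateGraph, Equiv.ofFiberEquiv_map, ne_eq, EmbeddingLike.apply_eq_iff_eq]

/-- The input that refines `v` and has the classes of equal elements given by `g`. -/
theorem Packable.exists_refines {n : ℕ} {I₀ : Fin n → ℕ} {v : Fin n → List Bool}
    (h : Packable I₀ v) :
    ∃ I : Fin n → TreeValue, Refines v I ∧ Nonempty (duplicateGraph I ≃g duplicateGraph I₀) := by
  obtain ⟨g, node, hg, hv⟩ := h
  refine ⟨fun u => toLex (node (g u), g u), fun u => hv u, ?_⟩
  have : duplicateGraph (fun u => (toLex (node (g u), g u) : TreeValue)) = duplicateGraph g := by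
    ext a b
    simp only [duplicateGraph, EmbeddingLike.apply_eq_iff_eq, Prod.mk.injEq]
    exact ⟨fun h => ⟨h.1, h.2.2⟩, fun h => ⟨h.1, by rw [h.2], h.2⟩⟩
  rw [this]
  exact duplicateGraph_iso_of_valueCount_eq hg

/-- If a correct comparison tree treats all refinements of `v` alike, then it reports that all
elements are distinct, and `v` separates all elements. -/
theorem output_eq_none_of_constant (A : DistinctnessAlgorithm) {n : ℕ} {v : Fin n → List Bool}
    {o : Option (Fin n × Fin n)} (h : ∀ I, Refines v I → (A.tree n).output I = o) : o = none := by
  have h1 := A.correct n TreeValue (fun u => toLex (v u, (u : ℕ)))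
  rw [h _ fun u => List.prefix_rfl] at h1
  match o, h1 with
  | none, _ => rfl
  | some (i, j), h1 =>
    have h2 := congrArg (fun x : TreeValue => (ofLex x).2) h1.2
    exact absurd (Fin.ext h2) h1.1

/-- On some input with the same classes of equal elements as `I₀`, the algorithm performs at least
`C` comparisons, provided that all nodes of total depth at most `2 C` can be fitted into them. -/
theorem exists_runtime_ge_of_packable (A : DistinctnessAlgorithm) {n C : ℕ} {I₀ : Fin n → ℕ}
    (hI₀ : ¬ Function.Injective I₀)
    (h : ∀ v : Fin n → List Bool, ∑ u, (v u).length ≤ 2 * C → Packable I₀ v) :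
    ∃ I : Fin n → TreeValue, Nonempty (duplicateGraph I ≃g duplicateGraph I₀) ∧
      C ≤ (A.tree n).runtime I := by
  obtain ⟨v, -, hv, hruns⟩ := ComparisonTree.exists_adversary C (A.tree n) fun _ => []
  obtain ⟨I, hI, ⟨e⟩⟩ := (h v (by simpa using hv)).exists_refines
  rcases hruns with hruns | ⟨o, ho⟩
  · exact ⟨I, ⟨e⟩, hruns I hI⟩
  · exfalso
    have h1 := A.correct n TreeValue I
    rw [ho I hI, output_eq_none_of_constant A ho] at h1
    simp only [Function.Injective, not_forall] at hI₀
    obtain ⟨a, b, hab, hne⟩ := hI₀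
    have h2 : (duplicateGraph I).Adj (e.symm a) (e.symm b) := e.symm.map_adj_iff.2 ⟨hne, hab⟩
    exact h1 _ _ h2.1 h2.2

/-- On inputs with distinct elements, a correct algorithm has to separate all elements, and only
`2 ^ d` of them fit on nodes of depth less than `d`. -/
theorem exists_runtime_ge_of_injective (A : DistinctnessAlgorithm) {n C d : ℕ} {I₀ : Fin n → ℕ}
    (hI₀ : Function.Injective I₀) (hC : 2 * C < (n - 2 ^ d) * d) :
    ∃ I : Fin n → TreeValue, Nonempty (duplicateGraph I ≃g duplicateGraph I₀) ∧
      C ≤ (A.tree n).runtime I := by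
  obtain ⟨v, -, hv, hruns⟩ := ComparisonTree.exists_adversary C (A.tree n) fun _ => []
  replace hv : ∑ u, (v u).length ≤ 2 * C := by simpa using hv
  rcases hruns with hruns | ⟨o, ho⟩
  · refine ⟨fun u => toLex (v u, I₀ u), ⟨⟨Equiv.refl _, ?_⟩⟩, hruns _ fun u => List.prefix_rfl⟩
    intro a b
    simp only [duplicateGraph, Equiv.refl_apply, EmbeddingLike.apply_eq_iff_eq, Prod.mk.injEq]
    refine ⟨fun h => absurd (hI₀ h.2) h.1, fun h => absurd (hI₀ h.2.2) h.1⟩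
  · exfalso
    have hinj : Function.Injective v := by
      intro i j hij
      by_contra hne
      have h1 := A.correct n TreeValue (fun u => toLex (v u, 0))
      rw [ho _ fun u => List.prefix_rfl, output_eq_none_of_constant A ho] at h1
      exact h1 i j hne (by simp [hij])
    have h1 := card_filter_length_lt_le v Finset.univ 1 d fun a =>
      Finset.card_le_one.2 fun i hi j hj => hinj (by simp_all)
    have h2 := (card_filter_length_ge_mul_le v Finset.univ d).trans hv
    have h3 := Finset.card_filter_add_card_filter_not (s := Finset.univ)
      (fun u => (v u).length < d)
    simp only [not_lt, Finset.card_univ, Fintype.card_fin] at h3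
    have h4 : (n - 2 ^ d) * d ≤ (Finset.univ.filter (fun u => d ≤ (v u).length)).card * d :=
      Nat.mul_le_mul_right _ (by omega)
    omega

/-! ### Procedures that stop at the first pair of equal elements -/

/-- Comparison procedures with results in `α` that stop as soon as a comparison shows two equal
elements; only the answers `lt` and `gt` lead to a continuation. -/
inductive Proc (n : ℕ) (α : Type) : Type
  | done (a : α) : Proc n α
  | ask (i j : Fin n) (h : i ≠ j) (lt gt : Proc n α) : Proc n α

namespace Proc

variable {n : ℕ} {α β : Type}

/-- The result on the input `I`, or `none` if equal elements have been found. -/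
def run (I : Fin n → ℕ) : Proc n α → Option α
  | done a => some a
  | ask i j _ lt gt => if I i < I j then lt.run I else if I j < I i then gt.run I else none

/-- The largest number of comparisons. -/
def depth : Proc n α → ℕ
  | done _ => 0
  | ask _ _ _ lt gt => max lt.depth gt.depth + 1

/-- Sequential composition. -/
def bind (K : α → Proc n β) : Proc n α → Proc n β
  | done a => K a
  | ask i j h lt gt => ask i j h (lt.bind K) (gt.bind K)

theorem run_bind (K : α → Proc n β) (P : Proc n α) (I : Fin n → ℕ) :
    (P.bind K).run I = (P.run I).bind fun a => (K a).run I := by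
  induction P with
  | done a => rfl
  | ask i j h lt gt ih1 ih2 =>
    simp only [bind, run]
    split_ifs
    · exact ih1
    · exact ih2
    · rfl

theorem depth_bind_le (K : α → Proc n β) {c : ℕ} (hK : ∀ a, (K a).depth ≤ c) (P : Proc n α) :
    (P.bind K).depth ≤ P.depth + c := by
  induction P with
  | done a => simpa [bind, depth] using hK a
  | ask i j h lt gt ih1 ih2 => simp only [bind, depth]; omega

end Proc

/-- Some procedure with at most `c` comparisons guarantees `Φ I a` for its result `a` on every input
`I` on which it does not find equal elements. -/
def Achieves {n : ℕ} {α : Type} (c : ℕ) (Φ : (Fin n → ℕ) → α → Prop) : Prop :=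
  ∃ P : Proc n α, P.depth ≤ c ∧ ∀ I a, P.run I = some a → Φ I a

namespace Achieves

variable {n : ℕ} {α β : Type}

theorem mono {c c' : ℕ} {Φ Ψ : (Fin n → ℕ) → α → Prop} (h : Achieves c Φ) (hc : c ≤ c')
    (hΦ : ∀ I a, Φ I a → Ψ I a) : Achieves c' Ψ := by
  obtain ⟨P, hP, h⟩ := h
  exact ⟨P, hP.trans hc, fun I a ha => hΦ I a (h I a ha)⟩

theorem pure {c : ℕ} {Φ : (Fin n → ℕ) → α → Prop} (a : α) (h : ∀ I, Φ I a) : Achieves c Φ :=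
  ⟨.done a, Nat.zero_le _, fun I b hb => by cases hb; exact h I⟩

/-- Sequential composition. The cost bound of the continuation may use every property of the
intermediate result `a` that `Φ` guarantees on some input. -/
theorem bind [Nonempty β] {c₁ c₂ : ℕ} {Φ : (Fin n → ℕ) → α → Prop}
    {Ψ : (Fin n → ℕ) → β → Prop} (h₁ : Achieves c₁ Φ)
    (h₂ : ∀ a I₀, Φ I₀ a → Achieves c₂ fun I b => Φ I a → Ψ I b) : Achieves (c₁ + c₂) Ψ := by
  classical
  obtain ⟨P, hP, h⟩ := h₁
  have hK : ∀ a, ∃ Q : Proc n β, Q.depth ≤ c₂ ∧ ∀ I, Φ I a → ∀ b, Q.run I = some b → Ψ I b := by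
    intro a
    by_cases ha : ∃ I₀, Φ I₀ a
    · obtain ⟨Q, hQ, hQ'⟩ := h₂ a _ ha.choose_spec
      exact ⟨Q, hQ, fun I hI b hb => hQ' I b hb hI⟩
    · exact ⟨.done (Classical.arbitrary β), Nat.zero_le _, fun I hI => absurd ⟨I, hI⟩ ha⟩
  choose K hKd hK using hK
  refine ⟨P.bind K, (Proc.depth_bind_le K hKd P).trans (Nat.add_le_add_right hP _),
    fun I b hb => ?_⟩
  rw [Proc.run_bind, Option.bind_eq_some_iff] at hb
  obtain ⟨a, ha, hb⟩ := hb
  exact hK a I (h I a ha) b hb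

theorem compare {i j : Fin n} (hij : i ≠ j) :
    Achieves 1 fun I (b : Bool) => if b then I i < I j else I j < I i := by
  refine ⟨.ask i j hij (.done true) (.done false), by simp [Proc.depth], fun I b hb => ?_⟩
  simp only [Proc.run] at hb
  split_ifs at hb with h1 h2 <;> cases hb <;> simpa

/-- Performing a task for every entry of a list. -/
theorem forall_mem (l : List α) (c : α → ℕ) {Φ : α → (Fin n → ℕ) → Prop}
    (h : ∀ a ∈ l, Achieves (c a) fun I (_ : Unit) => Φ a I) :
    Achieves (l.map c).sum fun I (_ : Unit) => ∀ a ∈ l, Φ a I := by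
  induction l with
  | nil => exact pure () (by simp)
  | cons a l ih =>
    rw [List.map_cons, List.sum_cons]
    refine bind (h a (by simp)) fun _ _ _ => ?_
    refine (ih fun b hb => h b (by simp [hb])).mono le_rfl fun I _ hI ha => ?_
    simpa using ⟨ha, hI⟩

end Achieves

/-! ### Sorting in groups -/

/-- The input `I` is strictly increasing along the list `l` of positions. -/
def IncreasingOn {n : ℕ} (I : Fin n → ℕ) (l : List (Fin n)) : Prop :=
  l.Pairwise fun a b => I a < I b

/-- Binary insertion. -/
theorem achieves_insert {n : ℕ} (k : ℕ) (l : List (Fin n)) (u : Fin n) (hl : l.length < 2 ^ k)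
    (hu : u ∉ l) :
    Achieves k fun I l' => l'.Perm (u :: l) ∧ (IncreasingOn I l → IncreasingOn I l') := by
  induction k generalizing l with
  | zero =>
    obtain rfl : l = [] := by simpa using hl
    exact Achieves.pure [u] fun I => by simp [IncreasingOn]
  | succ k ih =>
    rcases Nat.lt_or_ge l.length (2 ^ k) with h | h
    · exact (ih l h hu).mono (Nat.le_succ k) fun _ _ => id
    have hpos : 0 < 2 ^ k := by positivity
    obtain ⟨A, m, B, rfl, hA, hB⟩ : ∃ A m B, l = A ++ m :: B ∧ A.length < 2 ^ k ∧
        B.length < 2 ^ k := by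
      refine ⟨l.take (2 ^ k - 1), l[2 ^ k - 1], l.drop (2 ^ k), ?_, ?_, ?_⟩
      · have h1 := List.drop_eq_getElem_cons (l := l) (i := 2 ^ k - 1) (by omega)
        rw [show 2 ^ k - 1 + 1 = 2 ^ k by omega] at h1
        rw [← h1, List.take_append_drop]
      · rw [List.length_take]; omega
      · rw [List.length_drop]; rw [pow_succ] at hl; omega
    simp only [List.mem_append, List.mem_cons, not_or] at hu
    rw [add_comm]
    refine Achieves.bind (Achieves.compare hu.2.1) fun b _ _ => ?_
    have hu2 : ∀ I, IncreasingOn I (A ++ m :: B) ↔ (IncreasingOn I A ∧ IncreasingOn I B ∧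
        (∀ b ∈ B, I m < I b) ∧ (∀ a ∈ A, I a < I m) ∧ ∀ a ∈ A, ∀ b ∈ B, I a < I b) := by
      intro I
      simp only [IncreasingOn, List.pairwise_append, List.pairwise_cons, List.mem_cons,
        forall_eq_or_imp]
      constructor
      · rintro ⟨h1, ⟨h2, h3⟩, h4⟩
        exact ⟨h1, h3, h2, fun a ha => (h4 a ha).1, fun a ha => (h4 a ha).2⟩
      · rintro ⟨h1, h3, h2, h4, h5⟩
        exact ⟨h1, ⟨h2, h3⟩, fun a ha => ⟨h4 a ha, h5 a ha⟩⟩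
    cases b with
    | true =>
      refine (ih A hA hu.1).bind (c₂ := 0) (Ψ := fun I l' => I u < I m → _) fun A' I₀ hA' =>
        Achieves.pure (A' ++ m :: B) fun I hI hum => ⟨?_, fun hs => ?_⟩
      · exact hA'.1.append_right _
      · rw [hu2] at hs
        have hmem : ∀ a ∈ A', a = u ∨ a ∈ A := fun a ha => by
          simpa using hA'.1.mem_iff.1 ha
        rw [IncreasingOn, List.pairwise_append, List.pairwise_cons]
        refine ⟨hI.2 hs.1, ⟨hs.2.2.1, hs.2.1⟩, ?_⟩
        have hm : ∀ a ∈ A', I a < I m := fun a ha => by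
          rcases hmem a ha with rfl | ha
          · exact hum
          · exact hs.2.2.2.1 a ha
        intro a ha b hb
        rcases List.mem_cons.1 hb with rfl | hb
        · exact hm a ha
        · exact (hm a ha).trans (hs.2.2.1 b hb)
    | false =>
      refine (ih B hB hu.2.2).bind (c₂ := 0) (Ψ := fun I l' => I m < I u → _) fun B' I₀ hB' =>
        Achieves.pure (A ++ m :: B') fun I hI hmu => ⟨?_, fun hs => ?_⟩
      · refine ((hB'.1.cons m).trans (List.Perm.swap u m B)).append_left A |>.trans ?_
        exact List.perm_middle
      · rw [hu2] at hs
        have hmem : ∀ b ∈ B', b = u ∨ b ∈ B := fun b hb => by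
          simpa using hB'.1.mem_iff.1 hb
        rw [IncreasingOn, List.pairwise_append, List.pairwise_cons]
        have hm : ∀ b ∈ B', I m < I b := fun b hb => by
          rcases hmem b hb with rfl | hb
          · exact hmu
          · exact hs.2.2.1 b hb
        refine ⟨hs.1, ⟨hm, hI.2 hs.2.1⟩, ?_⟩
        intro a ha b hb
        rcases List.mem_cons.1 hb with rfl | hb
        · exact hs.2.2.2.1 a ha
        · exact (hs.2.2.2.1 a ha).trans (hm b hb)

/-- Sorting by binary insertion. -/
theorem achieves_sort {n : ℕ} (k : ℕ) (l : List (Fin n)) (hl : l.length ≤ 2 ^ k)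
    (hnd : l.Nodup) :
    Achieves (l.length * k) fun I l' => l'.Perm l ∧ IncreasingOn I l' := by
  induction l with
  | nil => exact Achieves.pure [] fun I => by simp [IncreasingOn]
  | cons u l ih =>
    rw [List.length_cons] at hl ⊢
    rw [Nat.succ_mul]
    rw [List.nodup_cons] at hnd
    refine (ih (by omega) hnd.2).bind fun l' _ hl' => ?_
    refine (achieves_insert k l' u ?_ ?_).mono le_rfl fun I l'' h h' => ?_
    · rw [hl'.1.length_eq]; omega
    · rw [hl'.1.mem_iff]; exact hnd.1
    · exact ⟨h.1.trans (h'.1.cons u), h.2 h'.2⟩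

/-- Sorting in groups of size `2 ^ k`. -/
theorem achieves_groups {n : ℕ} (k : ℕ) (l : List (Fin n)) (hnd : l.Nodup) :
    Achieves (l.length * k) fun I (gs : List (List (Fin n))) =>
      gs.flatten.Perm l ∧ (∀ G ∈ gs, IncreasingOn I G) ∧
      (∀ w, l.length ≤ w * 2 ^ k → gs.length ≤ w) ∧
      ∀ w, l.length = w * 2 ^ k → ∀ G ∈ gs, G.length = 2 ^ k := by
  have hpos : 0 < 2 ^ k := by positivity
  induction hm : l.length using Nat.strong_induction_on generalizing l with
  | _ m ih =>
    subst hm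
    rcases l.eq_nil_or_concat with rfl | hne
    · exact Achieves.pure [] fun I => by simp
    have hlen : 0 < l.length := by
      obtain ⟨l', b, rfl⟩ := hne
      simp
    have hsum : (l.take (2 ^ k)).length + (l.drop (2 ^ k)).length = l.length := by
      rw [← List.length_append, List.take_append_drop]
    have h1 := achieves_sort k (l.take (2 ^ k)) (by simp) (hnd.sublist (List.take_sublist _ _))
    have h2 := ih (l.drop (2 ^ k)).length (by rw [List.length_drop]; omega) (l.drop (2 ^ k))
      (hnd.sublist (List.drop_sublist _ _)) rfl
    rw [← hsum, Nat.add_mul]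
    refine h1.bind fun G _ _ => ?_
    refine (h2.bind (c₂ := 0) (Ψ := fun I gs' => _ → _) fun gs _ _ =>
      Achieves.pure (G :: gs) fun I hgs hG => ?_).mono le_rfl fun _ _ => id
    have hdrop : (l.drop (2 ^ k)).length = l.length - 2 ^ k := List.length_drop ..
    refine ⟨?_, ?_, ?_, ?_⟩
    · rw [List.flatten_cons]
      refine (hG.1.append hgs.1).trans ?_
      rw [List.take_append_drop]
    · intro G' hG'
      rcases List.mem_cons.1 hG' with rfl | hG'
      · exact hG.2
      · exact hgs.2.1 G' hG'
    · intro w hw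
      rw [hsum] at hw
      cases w with
      | zero => omega
      | succ w =>
        rw [List.length_cons]
        have := hgs.2.2.1 w (by rw [hdrop]; rw [Nat.succ_mul] at hw; omega)
        omega
    · intro w hw G' hG'
      rw [hsum] at hw
      cases w with
      | zero => omega
      | succ w =>
        rw [Nat.succ_mul] at hw
        rcases List.mem_cons.1 hG' with rfl | hG'
        · rw [hG.1.length_eq, List.length_take]; omega
        · exact hgs.2.2.2 w (by omega) G' hG'

/-- After sorting in groups without finding equal elements, no value occurs more often than there
are groups. -/
theorem achieves_groupCheck {n : ℕ} (k : ℕ) (l : List (Fin n)) (hnd : l.Nodup) :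
    Achieves (l.length * k) fun I (_ : Unit) =>
      ∀ w, l.length ≤ w * 2 ^ k → ∀ x, l.countP (I · = x) ≤ w := by
  refine (achieves_groups k l hnd).bind (c₂ := 0) fun gs _ _ =>
    Achieves.pure () fun I hgs w hw x => ?_
  rw [← hgs.1.countP_eq, List.countP_flatten]
  refine le_trans ?_ (hgs.2.2.1 w hw)
  refine (List.sum_le_card_nsmul _ 1 ?_).trans (by simp)
  intro c hc
  obtain ⟨G, hG, rfl⟩ := List.mem_map.1 hc
  have hinc := hgs.2.1 G hG
  clear hc hG hw hgs
  induction G with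
  | nil => simp
  | cons a G ih =>
    rw [IncreasingOn, List.pairwise_cons] at hinc
    rw [List.countP_cons]
    split_ifs with ha
    · have : G.countP (I · = x) = 0 := by
        rw [List.countP_eq_zero]
        intro b hb
        have := hinc.1 b hb
        simp only [decide_eq_true_eq] at ha ⊢
        omega
      rw [this]
    · exact ih hinc.2

/-! ### Initial segments of the order -/

/-- Comparing all entries of a list with a pivot. -/
theorem achieves_split {n : ℕ} (x : Fin n) (l : List (Fin n)) (hx : x ∉ l) (hnd : l.Nodup) :
    Achieves l.length fun I (Z : List (Fin n)) => Z.Sublist l ∧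
      ∀ a ∈ l, (a ∈ Z → I a < I x) ∧ (a ∉ Z → I x < I a) := by
  induction l with
  | nil => exact Achieves.pure [] fun I => by simp
  | cons u l ih =>
    rw [List.mem_cons, not_or] at hx
    rw [List.nodup_cons] at hnd
    rw [List.length_cons]
    refine (ih hx.2 hnd.2).bind fun Z _ _ =>
      ((Achieves.compare (Ne.symm hx.1)).bind (c₂ := 0) (Ψ := fun I Z' => _ → _) fun b _ _ =>
        Achieves.pure (if b then u :: Z else Z) fun I hb hZ => ?_).mono le_rfl fun _ _ => id
    have huZ : u ∉ Z := fun h => hnd.1 (hZ.1.subset h)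
    cases b with
    | true =>
      simp only [if_true] at hb ⊢
      refine ⟨hZ.1.cons_cons u, fun a ha => ?_⟩
      rcases List.mem_cons.1 ha with rfl | ha
      · exact ⟨fun _ => hb, fun h => absurd (by simp) h⟩
      · refine ⟨fun h => ?_, fun h => (hZ.2 a ha).2 fun h' => h (by simp [h'])⟩
        rcases List.mem_cons.1 h with rfl | h
        · exact hb
        · exact (hZ.2 a ha).1 h
    | false =>
      simp only [Bool.false_eq_true, if_false] at hb ⊢
      refine ⟨hZ.1.cons u, fun a ha => ?_⟩
      rcases List.mem_cons.1 ha with rfl | ha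
      · exact ⟨fun h => absurd h huZ, fun _ => hb⟩
      · exact hZ.2 a ha

theorem IncreasingOn.countP_le {n : ℕ} {I : Fin n → ℕ} {l : List (Fin n)} (h : IncreasingOn I l)
    {i : ℕ} (hi : i < l.length) {y : ℕ} (hy : I l[i] ≤ y) : i + 1 ≤ l.countP (I · ≤ y) := by
  have h1 : (l.take (i + 1)).countP (I · ≤ y) = (l.take (i + 1)).length := by
    rw [List.countP_eq_length]
    intro a ha
    obtain ⟨j, hj, rfl⟩ := List.getElem_of_mem ha
    rw [List.length_take] at hj
    rw [List.getElem_take, decide_eq_true_eq]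
    rcases Nat.lt_or_ge j i with hji | hji
    · exact (List.pairwise_iff_getElem.1 h j i (by omega) hi hji).le.trans hy
    · obtain rfl : j = i := by omega
      exact hy
  have h2 := (List.take_sublist (i + 1) l).countP_le (p := (I · ≤ y))
  rw [h1, List.length_take] at h2
  omega

theorem IncreasingOn.countP_ge {n : ℕ} {I : Fin n → ℕ} {l : List (Fin n)} (h : IncreasingOn I l)
    {i : ℕ} (hi : i < l.length) {y : ℕ} (hy : y ≤ I l[i]) :
    l.length - i ≤ l.countP (y ≤ I ·) := by
  have h1 : (l.drop i).countP (y ≤ I ·) = (l.drop i).length := by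
    rw [List.countP_eq_length]
    intro a ha
    obtain ⟨j, hj, rfl⟩ := List.getElem_of_mem ha
    rw [List.length_drop] at hj
    rw [List.getElem_drop, decide_eq_true_eq]
    rcases Nat.eq_zero_or_pos j with rfl | hj0
    · simpa using hy
    · exact hy.trans (List.pairwise_iff_getElem.1 h i (i + j) hi (by omega) (by omega)).le
  have h2 := (List.drop_sublist i l).countP_le (p := (y ≤ I ·))
  rwa [h1, List.length_drop] at h2

theorem List.mul_countP_le_countP_flatten {α : Type*} {gs : List (List α)} {h : ℕ} {p : α → Bool}
    {q : List α → Bool} (hgs : ∀ G ∈ gs, q G → h ≤ G.countP p) :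
    h * gs.countP q ≤ gs.flatten.countP p := by
  induction gs with
  | nil => simp
  | cons G gs ih =>
    have h1 := ih fun G' hG' => hgs G' (by simp [hG'])
    have h2 := hgs G (by simp)
    rw [List.countP_cons, List.flatten_cons, List.countP_append, Nat.mul_add]
    split_ifs with hq
    · have := h2 hq
      omega
    · omega

/-- The median of the medians of sorted groups of size `2 * h` has at least about a quarter of the
elements on either side. -/
theorem countP_median_of_medians {n h : ℕ} {I : Fin n → ℕ} {gs : List (List (Fin n))}
    (x₀ : Fin n) (hh : 1 ≤ h) (hinc : ∀ G ∈ gs, IncreasingOn I G)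
    (hlen : ∀ G ∈ gs, G.length = 2 * h)
    {ms : List (Fin n)} (hms : ms.Perm (gs.map fun G => G.getD h x₀)) (hmsI : IncreasingOn I ms)
    {i : ℕ} (hi : i < ms.length) :
    h * (i + 1) ≤ gs.flatten.countP (I · ≤ I ms[i]) ∧
      h * (ms.length - i) ≤ gs.flatten.countP (I ms[i] ≤ I ·) := by
  have hget : ∀ G ∈ gs, ∃ hG : h < G.length, G.getD h x₀ = G[h] := fun G hG => by
    have : h < G.length := by rw [hlen G hG]; omega
    exact ⟨this, by simp [this]⟩
  constructor
  · have h1 := hmsI.countP_le hi le_rfl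
    rw [hms.countP_eq, List.countP_map] at h1
    refine (Nat.mul_le_mul_left h h1).trans (List.mul_countP_le_countP_flatten ?_)
    intro G hG hq
    obtain ⟨hlt, hG'⟩ := hget G hG
    simp only [Function.comp_apply, decide_eq_true_eq, hG'] at hq
    exact (Nat.le_succ h).trans ((hinc G hG).countP_le hlt hq)
  · have h1 := hmsI.countP_ge hi le_rfl
    rw [hms.countP_eq (p := fun u => decide (I ms[i] ≤ I u)), List.countP_map] at h1
    refine (Nat.mul_le_mul_left h h1).trans (List.mul_countP_le_countP_flatten ?_)
    intro G hG hq
    obtain ⟨hlt, hG'⟩ := hget G hG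
    simp only [Function.comp_apply, decide_eq_true_eq, hG'] at hq
    refine le_trans ?_ ((hinc G hG).countP_ge hlt hq)
    rw [hlen G hG]
    omega

/-- Splitting off an initial segment with between one and seven eighths of the elements. The pivot
is the median of the medians of sorted groups of size `2 ^ k`, which is large enough for the medians
to be sorted with linearly many comparisons. -/
theorem achieves_initialSegment {n k q : ℕ} (l : List (Fin n)) (hnd : l.Nodup) (hk : 1 ≤ k)
    (hlen : 8 * 2 ^ k ≤ l.length) (hq : l.length ≤ 2 ^ q) (hqk : q ≤ 2 ^ k) :
    Achieves (l.length * (k + 2)) fun I (Z : List (Fin n)) => Z.Nodup ∧ (∀ a ∈ Z, a ∈ l) ∧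
      (∀ a ∈ Z, ∀ b ∈ l, b ∉ Z → I a < I b) ∧ l.length ≤ 8 * Z.length ∧
      8 * Z.length ≤ 7 * l.length := by
  obtain ⟨h, hh⟩ : ∃ h, h = 2 ^ (k - 1) := ⟨_, rfl⟩
  have hh1 : 1 ≤ h := hh ▸ Nat.one_le_two_pow
  have hgh : 2 ^ k = 2 * h := by rw [hh, ← pow_succ', Nat.sub_add_cancel hk]
  obtain ⟨r, hr⟩ : ∃ r, r = l.length / 2 ^ k := ⟨_, rfl⟩
  have hr1 : r * 2 ^ k ≤ l.length := hr ▸ Nat.div_mul_le_self _ _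
  have hr2 : l.length < (r + 1) * 2 ^ k := by
    rw [hr, mul_comm]; exact Nat.lt_mul_div_succ _ (by positivity)
  have hr8 : 8 ≤ r := hr ▸ (Nat.le_div_iff_mul_le (by positivity)).2 hlen
  obtain ⟨x₀, hx₀⟩ : ∃ x, x ∈ l := List.exists_mem_of_length_pos (by omega)
  obtain ⟨l₁, hl₁⟩ : ∃ l₁, l₁ = l.take (r * 2 ^ k) := ⟨_, rfl⟩
  have hl₁len : l₁.length = r * 2 ^ k := by rw [hl₁, List.length_take]; omega
  have hl₁sub : l₁.Sublist l := hl₁ ▸ List.take_sublist _ _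
  have hcost : l.length * (k + 2) = l.length * k + (l.length + l.length) := by ring
  rw [hcost]
  refine ((achieves_groups k l₁ (hnd.sublist hl₁sub)).mono
    (Nat.mul_le_mul_right _ hl₁sub.length_le) fun _ _ => id).bind fun gs I₀ hgs => ?_
  have hglen : ∀ G ∈ gs, G.length = 2 * h := hgh ▸ hgs.2.2.2 r hl₁len
  have hgslen : gs.length = r := by
    have h1 := hgs.1.length_eq
    rw [List.length_flatten, hl₁len, List.map_congr_left (g := fun _ => 2 ^ k)
      (fun G hG => by rw [hglen G hG, hgh])] at h1
    simpa using h1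
  have hgsnd : gs.flatten.Nodup := hgs.1.nodup_iff.2 (hnd.sublist hl₁sub)
  have hmed : ∀ G ∈ gs, G.getD h x₀ ∈ G := fun G hG => by
    have : h < G.length := by rw [hglen G hG]; omega
    simp [this]
  have hmsnd : (gs.map fun G => G.getD h x₀).Nodup := by
    rw [List.nodup_flatten] at hgsnd
    rw [List.Nodup, List.pairwise_map]
    refine hgsnd.2.imp_of_mem fun {G G'} hG hG' hdis heq => ?_
    exact hdis (hmed G hG) (heq ▸ hmed G' hG')
  have hrq : r ≤ 2 ^ q := by
    have : r * 1 ≤ r * 2 ^ k := Nat.mul_le_mul_left _ Nat.one_le_two_pow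
    omega
  refine Achieves.bind (c₁ := l.length) (((achieves_sort q (gs.map fun G => G.getD h x₀)
    (by simpa [hgslen] using hrq) hmsnd).mono
      (by
        rw [List.length_map, hgslen]
        exact (Nat.mul_le_mul_left r hqk).trans hr1) fun _ _ => id)) fun ms I₁ hms => ?_
  have hmslen : ms.length = r := by rw [hms.1.length_eq, List.length_map, hgslen]
  have hi : r / 2 < ms.length := by omega
  obtain ⟨x, hx⟩ : ∃ x, x = ms[r / 2] := ⟨_, rfl⟩
  have hxl : x ∈ l := by
    have h1 : x ∈ ms := hx ▸ List.getElem_mem hi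
    rw [hms.1.mem_iff, List.mem_map] at h1
    obtain ⟨G, hG, rfl⟩ := h1
    exact hl₁sub.subset (hgs.1.mem_iff.1 (List.mem_flatten.2 ⟨G, hG, hmed G hG⟩))
  refine ((achieves_split x (l.erase x) hnd.not_mem_erase (hnd.erase x)).mono
    (List.erase_sublist.length_le) fun _ _ => id).bind (c₂ := 0) (Ψ := fun I Z => _ → _ → _)
    fun Z _ _ => Achieves.pure (x :: Z) fun I hZ hmsI hgsI => ?_
  have hcount := countP_median_of_medians x₀ hh1 hgsI.2.1 hglen hmsI.1 hmsI.2 hi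
  rw [← hx, hmslen] at hcount
  have hsub : ∀ p : Fin n → Bool, gs.flatten.countP p ≤ l.countP p := fun p => by
    rw [hgsI.1.countP_eq]; exact hl₁sub.countP_le
  have hZnd : Z.Nodup := (hnd.erase x).sublist hZ.1
  have hZl : ∀ a ∈ Z, a ∈ l := fun a ha => List.mem_of_mem_erase (hZ.1.subset ha)
  have hZlt : ∀ a ∈ Z, I a < I x := fun a ha => (hZ.2 a (hZ.1.subset ha)).1 ha
  have hxZ : x ∉ Z := fun hx' => lt_irrefl _ (hZlt x hx')
  have hgt : ∀ b ∈ l, b ≠ x → b ∉ Z → I x < I b := fun b hb hbx hbZ =>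
    (hZ.2 b ((List.mem_erase_of_ne hbx).2 hb)).2 hbZ
  refine ⟨List.nodup_cons.2 ⟨hxZ, hZnd⟩, ?_, ?_, ?_, ?_⟩
  · intro a ha
    rcases List.mem_cons.1 ha with rfl | ha
    · exact hxl
    · exact hZl a ha
  · intro a ha b hb hbZ
    rw [List.mem_cons, not_or] at hbZ
    rcases List.mem_cons.1 ha with rfl | ha
    · exact hgt b hb hbZ.1 hbZ.2
    · exact (hZlt a ha).trans (hgt b hb hbZ.1 hbZ.2)
  · have h1 : l.countP (I · ≤ I x) ≤ (x :: Z).length := by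
      rw [List.countP_eq_length_filter]
      refine (List.subperm_of_subset (hnd.filter _) fun a ha => ?_).length_le
      rw [List.mem_filter, decide_eq_true_eq] at ha
      by_contra hcon
      rw [List.mem_cons, not_or] at hcon
      exact absurd (hgt a ha.1 hcon.1 hcon.2) (not_lt.2 ha.2)
    have h2 : h * (r + 1) ≤ 2 * (h * (r / 2 + 1)) := by
      rw [mul_left_comm]
      exact Nat.mul_le_mul_left _ (by omega)
    have h3 := hcount.1.trans ((hsub _).trans h1)
    have h4 : (r + 1) * 2 ^ k = 2 * (h * (r + 1)) := by rw [hgh]; ring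
    omega
  · have h1 : Z.length + l.countP (I x ≤ I ·) ≤ l.length := by
      rw [List.countP_eq_length_filter, ← List.length_append]
      refine (List.subperm_of_subset ?_ fun a ha => ?_).length_le
      · rw [List.nodup_append']
        refine ⟨hZnd, hnd.filter _, fun a ha ha' => ?_⟩
        rw [List.mem_filter, decide_eq_true_eq] at ha'
        exact absurd (hZlt a ha) (not_lt.2 ha'.2)
      · rcases List.mem_append.1 ha with ha | ha
        · exact hZl a ha
        · exact (List.mem_filter.1 ha).1
    have h2 : h * r ≤ 2 * (h * (r - r / 2)) := by
      rw [mul_left_comm]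
      exact Nat.mul_le_mul_left _ (by omega)
    have h3 := hcount.2.trans (hsub _)
    have h4 : (r + 1) * 2 ^ k = 2 * (h * r) + 2 ^ k := by rw [hgh]; ring
    rw [List.length_cons]
    omega

/-- A chain of initial segments of all sizes from `θ` on, up to a factor `8`. -/
theorem achieves_chain {n k q θ : ℕ} (hk : 1 ≤ k) (hθ : 2 ^ k ≤ θ) (hqk : q ≤ 2 ^ k) (m : ℕ)
    (l : List (Fin n)) (hnd : l.Nodup) (hq : l.length ≤ 2 ^ q)
    (hm : l.length * 7 ^ m ≤ 8 * θ * 8 ^ m) :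
    Achieves (l.length * (8 * (k + 2))) fun I (ch : List (List (Fin n))) => ch.length ≤ m + 1 ∧
      (∀ Y ∈ ch, Y.Nodup ∧ (∀ a ∈ Y, a ∈ l) ∧ ∀ a ∈ Y, ∀ b ∈ l, b ∉ Y → I a < I b) ∧
      ∀ t ≤ l.length, ∃ Y ∈ ch, t ≤ Y.length ∧ Y.length ≤ 8 * max t θ := by
  induction m generalizing l with
  | zero =>
    refine Achieves.pure [l] fun I => ⟨by simp, by simp [hnd]; tauto, fun t ht => ?_⟩
    exact ⟨l, by simp, ht, by have := le_max_right t θ; omega⟩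
  | succ m ih =>
    rcases Nat.lt_or_ge (8 * θ) l.length with hlt | hle
    · have hcost : l.length * (8 * (k + 2)) =
          l.length * (k + 2) + l.length * (7 * (k + 2)) := by ring
      rw [hcost]
      refine (achieves_initialSegment l hnd hk (by omega) hq hqk).bind fun Z _ hZ => ?_
      refine ((ih Z hZ.1 (by omega) ?_).bind (c₂ := 0) (Ψ := fun I Z' => _ → _) fun ch _ _ =>
        Achieves.pure (l :: ch) fun I hch hZI => ?_).mono ?_ fun _ _ => id
      · have h1 : 8 * (Z.length * 7 ^ m) ≤ 8 * (8 * θ * 8 ^ m) := by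
          calc 8 * (Z.length * 7 ^ m) = (8 * Z.length) * 7 ^ m := by ring
            _ ≤ (7 * l.length) * 7 ^ m := Nat.mul_le_mul_right _ hZ.2.2.2.2
            _ = l.length * 7 ^ (m + 1) := by ring
            _ ≤ 8 * θ * 8 ^ (m + 1) := hm
            _ = 8 * (8 * θ * 8 ^ m) := by ring
        omega
      · refine ⟨by simpa using hch.1, ?_, fun t ht => ?_⟩
        · intro Y hY
          rcases List.mem_cons.1 hY with rfl | hY
          · exact ⟨hnd, fun a ha => ha, fun a _ b hb hb' => absurd hb hb'⟩
          · obtain ⟨h1, h2, h3⟩ := hch.2.1 Y hY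
            refine ⟨h1, fun a ha => hZI.2.1 a (h2 a ha), fun a ha b hb hbY => ?_⟩
            by_cases hbZ : b ∈ Z
            · exact h3 a ha b hbZ hbY
            · exact hZI.2.2.1 a (h2 a ha) b hb hbZ
        · rcases Nat.lt_or_ge Z.length t with htZ | htZ
          · refine ⟨l, by simp, ht, ?_⟩
            have := le_max_left t θ
            have := hZI.2.2.2.1
            omega
          · obtain ⟨Y, hY, hY'⟩ := hch.2.2 t htZ
            exact ⟨Y, by simp [hY], hY'⟩
      · have := Nat.mul_le_mul_right (k + 2) hZ.2.2.2.2
        linarith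
    · refine Achieves.pure [l] fun I => ⟨by simp, by simp [hnd]; tauto, fun t ht => ?_⟩
      exact ⟨l, by simp, ht, by have := le_max_right t θ; omega⟩

/-! ### One round of the algorithm -/

theorem countP_eq_card_filter_toFinset {n : ℕ} (I : Fin n → ℕ) {l : List (Fin n)}
    (hnd : l.Nodup) (x : ℕ) : l.countP (I · = x) = (l.toFinset.filter (I · = x)).card := by
  rw [List.countP_eq_length_filter, ← List.toFinset_card_of_nodup (hnd.filter _),
    List.toFinset_filter]
  simp

theorem length_eq_sum_countP {n : ℕ} (I : Fin n → ℕ) {l : List (Fin n)} (hnd : l.Nodup) :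
    l.length = ∑ x ∈ Finset.univ.image I, l.countP (I · = x) := by
  rw [← List.toFinset_card_of_nodup hnd, Finset.card_eq_sum_card_fiberwise (f := I)
    (t := Finset.univ.image I) (fun a _ => Finset.mem_image_of_mem I (Finset.mem_univ a))]
  exact Finset.sum_congr rfl fun x _ => (countP_eq_card_filter_toFinset I hnd x).symm

theorem countP_le_valueCount {n : ℕ} (I : Fin n → ℕ) {l : List (Fin n)} (hnd : l.Nodup) (x : ℕ) :
    l.countP (I · = x) ≤ valueCount I x := by
  rw [countP_eq_card_filter_toFinset I hnd]
  exact Finset.card_le_card (Finset.filter_subset_filter _ (Finset.subset_univ _))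

theorem length_le_cappedSize {n w : ℕ} {I : Fin n → ℕ} {l : List (Fin n)} (hnd : l.Nodup)
    (h : ∀ x, l.countP (I · = x) ≤ w) : l.length ≤ cappedSize I w := by
  rw [length_eq_sum_countP I hnd]
  exact Finset.sum_le_sum fun x _ => le_min (countP_le_valueCount I hnd x) (h x)

theorem length_le_rareSize {n w : ℕ} {I : Fin n → ℕ} {l : List (Fin n)} (hnd : l.Nodup)
    (h : ∀ x, l.countP (I · = x) ≤ w) (hl : ∀ a ∈ l, ∀ b, b ∉ l → I a < I b) :
    l.length ≤ rareSize I w := by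
  rw [length_eq_sum_countP I hnd, rareSize, Finset.sum_filter]
  refine Finset.sum_le_sum fun x _ => ?_
  by_cases hx : ∃ a ∈ l, I a = x
  · obtain ⟨a, ha, rfl⟩ := hx
    have hall : l.countP (I · = I a) = valueCount I (I a) := by
      rw [countP_eq_card_filter_toFinset I hnd, valueCount]
      congr 1
      ext b
      simp only [Finset.mem_filter, List.mem_toFinset, Finset.mem_univ, true_and,
        and_iff_right_iff_imp]
      intro hb
      by_contra hbl
      exact absurd hb (hl a ha b hbl).ne'
    rw [if_pos (hall ▸ h (I a)), hall]
  · have : l.countP (I · = x) = 0 := by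
      rw [List.countP_eq_zero]
      intro a ha hax
      exact hx ⟨a, ha, by simpa using hax⟩
    rw [this]
    exact Nat.zero_le _

theorem injective_of_le_cappedSize_one {n : ℕ} {I : Fin n → ℕ} (h : n ≤ cappedSize I 1) :
    Function.Injective I := by
  have h1 : cappedSize I 1 ≤ (Finset.univ.image I).card := by
    rw [Finset.card_eq_sum_ones]
    unfold cappedSize truncatedCapacity
    gcongr
    exact min_le_right _ _
  have h2 : (Finset.univ.image I).card = (Finset.univ : Finset (Fin n)).card :=
    le_antisymm Finset.card_image_le (by simpa using h.trans h1)
  simpa [Set.injOn_univ] using Finset.card_image_iff.1 h2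

/-- The last round sorts the whole input. -/
theorem PrefixBound.injective {n b ℓ : ℕ} {I : Fin n → ℕ} (h : PrefixBound I b ℓ)
    (hb : n ≤ 2 ^ (b - ℓ)) (hℓb : ℓ ≤ b) (hℓ : n ≤ 2 ^ 2 ^ ℓ) : Function.Injective I := by
  have h1 := h (b - ℓ) (Nat.sub_le _ _) 1
  rw [min_eq_left hb, show min (b - (b - ℓ)) ℓ = ℓ by omega, one_mul] at h1
  exact injective_of_le_cappedSize_one (h1 hℓ)

/-- Only `ℓ` of the terms are as large as `2 ^ b`; the others form a geometric series. -/
theorem sum_two_pow_min_le (b ℓ : ℕ) :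
    ∑ i ∈ Finset.range (b + 1), 2 ^ min b (i + ℓ) ≤ (ℓ + 2) * 2 ^ b := by
  suffices h : ∑ i ∈ Finset.range (b + 1), 2 ^ min b (i + ℓ) + 2 ^ min ℓ b ≤
      (min ℓ b + 2) * 2 ^ b by
    have h1 : (min ℓ b + 2) * 2 ^ b ≤ (ℓ + 2) * 2 ^ b :=
      Nat.mul_le_mul_right _ (by have := min_le_left ℓ b; omega)
    exact (Nat.le_add_right _ _).trans (h.trans h1)
  induction b with
  | zero => simp
  | succ b ih =>
    rw [Finset.sum_range_succ']
    have h1 : ∀ i, 2 ^ min (b + 1) (i + 1 + ℓ) = 2 * 2 ^ min b (i + ℓ) := fun i => by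
      rw [← pow_succ']; congr 1; omega
    simp only [h1, ← Finset.mul_sum, zero_add]
    rw [pow_succ 2 b]
    rcases Nat.lt_or_ge b ℓ with hb | hb
    · rw [min_eq_right hb.le] at ih
      rw [min_eq_left (show b + 1 ≤ ℓ by omega), min_eq_right (show b + 1 ≤ ℓ by omega), pow_succ]
      nlinarith
    · rw [min_eq_left hb] at ih
      rw [min_eq_right (show ℓ ≤ b + 1 by omega), min_eq_left (show ℓ ≤ b + 1 by omega)]
      nlinarith

theorem achieves_prefixBound (n b ℓ : ℕ) :
    Achieves ((ℓ + 2) * 2 ^ b) fun (I : Fin n → ℕ) (_ : Unit) => PrefixBound I b ℓ := by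
  refine (Achieves.forall_mem (List.range (b + 1)) (fun i => 2 ^ min b (i + ℓ))
    (Φ := fun i I => ∀ w, ((List.finRange n).take (2 ^ i)).length ≤ w * 2 ^ 2 ^ min (b - i) ℓ →
      ∀ x, ((List.finRange n).take (2 ^ i)).countP (I · = x) ≤ w) fun i hi =>
      (achieves_groupCheck (2 ^ min (b - i) ℓ) _
        ((List.nodup_finRange n).sublist (List.take_sublist _ _))).mono ?_ fun _ _ => id).mono
    ?_ fun I _ h i hi w hw => ?_
  · rw [List.mem_range] at hi
    calc _ ≤ 2 ^ i * 2 ^ min (b - i) ℓ := Nat.mul_le_mul_right _ (by simp)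
      _ = 2 ^ min b (i + ℓ) := by rw [← pow_add]; congr 1; omega
  · exact sum_two_pow_min_le b ℓ
  · have hlen : ((List.finRange n).take (2 ^ i)).length = min n (2 ^ i) := by
      simp [min_comm]
    rw [← hlen] at hw ⊢
    exact length_le_cappedSize ((List.nodup_finRange n).sublist (List.take_sublist _ _))
      (h i (List.mem_range.2 (by omega)) w hw)

theorem achieves_initialSegmentBound {n b ℓ θ q : ℕ} (hℓ : 1 ≤ ℓ) (hθ : 2 ^ ℓ ≤ θ)
    (hq : n ≤ 2 ^ q) (hqℓ : q ≤ 2 ^ ℓ) (hn : n ≤ 8 * θ * 2 ^ ℓ) :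
    Achieves ((14 * ℓ + 17) * 2 ^ b) fun (I : Fin n → ℕ) (_ : Unit) =>
      InitialSegmentBound I b ℓ θ := by
  by_cases hnb : n ≤ 2 ^ b
  swap
  · exact Achieves.pure () fun I h => absurd h hnb
  -- The chain reaches size `θ` after `6 ℓ` steps, because `(8 / 7) ^ 6 ≥ 2`.
  have hpow : 2 ^ ℓ * 7 ^ (6 * ℓ) ≤ 8 ^ (6 * ℓ) := by
    rw [pow_mul, pow_mul, ← mul_pow]
    exact Nat.pow_le_pow_left (by norm_num) _
  have hm : (List.finRange n).length * 7 ^ (6 * ℓ) ≤ 8 * θ * 8 ^ (6 * ℓ) := by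
    rw [List.length_finRange]
    calc n * 7 ^ (6 * ℓ) ≤ 8 * θ * 2 ^ ℓ * 7 ^ (6 * ℓ) := Nat.mul_le_mul_right _ hn
      _ = 8 * θ * (2 ^ ℓ * 7 ^ (6 * ℓ)) := by ring
      _ ≤ _ := Nat.mul_le_mul_left _ hpow
  have hcost : (14 * ℓ + 17) * 2 ^ b = 2 ^ b * (8 * (ℓ + 2)) + (6 * ℓ + 1) * 2 ^ b := by ring
  rw [hcost]
  refine ((achieves_chain hℓ hθ hqℓ (6 * ℓ) (List.finRange n) (List.nodup_finRange n)
    (by simpa using hq) hm).mono (Nat.mul_le_mul_right _ (by simpa using hnb))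
    fun _ _ => id).bind fun ch _ hch => ?_
  refine (Achieves.forall_mem ch (fun _ => 2 ^ b)
    (Φ := fun Y I => ∀ w, Y.length ≤ w * 2 ^ min (2 ^ b / Y.length) (2 ^ ℓ) →
      ∀ x, Y.countP (I · = x) ≤ w) fun Y hY =>
      (achieves_groupCheck (min (2 ^ b / Y.length) (2 ^ ℓ)) Y (hch.2.1 Y hY).1).mono ?_
        fun _ _ => id).mono ?_ fun I _ h hchI _ t ht => ?_
  · exact (Nat.mul_le_mul_left _ (min_le_left _ _)).trans (Nat.mul_div_le _ _)
  · rw [List.map_const', List.sum_replicate, smul_eq_mul]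
    exact Nat.mul_le_mul_right _ hch.1
  · obtain ⟨Y, hY, htY, hYt⟩ := hchI.2.2 t (by simpa using ht)
    obtain ⟨hnd, -, hYlt⟩ := hchI.2.1 Y hY
    refine ⟨Y.length, htY, ?_, hYt, fun w hw => ?_⟩
    · simpa using hnd.length_le_card
    · exact length_le_rareSize hnd (h Y hY w hw) fun a ha c hc => hYlt a ha c (by simp) hc

theorem achieves_round {n b ℓ θ q : ℕ} (hℓ : 1 ≤ ℓ) (hθ : 2 ^ ℓ ≤ θ)
    (hq : n ≤ 2 ^ q) (hqℓ : q ≤ 2 ^ ℓ) (hn : n ≤ 8 * θ * 2 ^ ℓ) :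
    Achieves (34 * ℓ * 2 ^ b) fun (I : Fin n → ℕ) (_ : Unit) =>
      PrefixBound I b ℓ ∧ InitialSegmentBound I b ℓ θ := by
  refine ((achieves_prefixBound n b ℓ).bind fun _ _ _ =>
    (achieves_initialSegmentBound hℓ hθ hq hqℓ hn).mono le_rfl fun _ _ h h' => ⟨h', h⟩).mono ?_
    fun _ _ => id
  rw [← Nat.add_mul]
  exact Nat.mul_le_mul_right _ (by omega)

/-! ### The algorithm -/

namespace Proc

variable {n : ℕ}

/-- The comparison tree that performs a procedure, reports the first pair of equal elements that it
finds, and continues with the tree `T` if it finds none. -/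
def toTree (T : ComparisonTree n) : Proc n Unit → ComparisonTree n
  | done _ => T
  | ask i j _ lt gt => .compare i j fun
    | .lt => lt.toTree T
    | .eq => .reportPair i j
    | .gt => gt.toTree T

theorem toTree_of_run_eq_none (T : ComparisonTree n) {P : Proc n Unit} {I : Fin n → ℕ}
    (h : P.run I = none) : IsCorrectAnswer I ((P.toTree T).output I) ∧
      (P.toTree T).runtime I ≤ P.depth := by
  induction P with
  | done a => simp [run] at h
  | ask i j hij lt gt ih1 ih2 =>
    simp only [run] at h
    simp only [toTree, ComparisonTree.output, ComparisonTree.runtime, depth]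
    rcases lt_trichotomy (I i) (I j) with hlt | heq | hgt
    · rw [if_pos hlt] at h
      rw [hlt.cmp_eq_lt]
      exact ⟨(ih1 h).1, Nat.succ_le_succ ((ih1 h).2.trans (le_max_left _ _))⟩
    · rw [heq, cmp_self_eq_eq]
      exact ⟨⟨hij, heq⟩, by simp [ComparisonTree.runtime]⟩
    · rw [if_neg hgt.not_gt, if_pos hgt] at h
      rw [hgt.cmp_eq_gt]
      exact ⟨(ih2 h).1, Nat.succ_le_succ ((ih2 h).2.trans (le_max_right _ _))⟩

theorem toTree_of_run_eq_some (T : ComparisonTree n) {P : Proc n Unit} {I : Fin n → ℕ}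
    (h : P.run I = some ()) : (P.toTree T).output I = T.output I ∧
      (P.toTree T).runtime I ≤ P.depth + T.runtime I := by
  induction P with
  | done a => simp [toTree, depth]
  | ask i j hij lt gt ih1 ih2 =>
    simp only [run] at h
    simp only [toTree, ComparisonTree.output, ComparisonTree.runtime, depth]
    split_ifs at h with hlt hgt
    · rw [hlt.cmp_eq_lt]
      refine ⟨(ih1 h).1, ?_⟩
      have := (ih1 h).2
      have := le_max_left lt.depth gt.depth
      simp only
      omega
    · rw [hgt.cmp_eq_gt]
      refine ⟨(ih2 h).1, ?_⟩
      have := (ih2 h).2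
      have := le_max_right lt.depth gt.depth
      simp only
      omega

end Proc

/-- The rounds `b, …, b + N - 1`, one after the other. -/
def roundsTree {n : ℕ} (P : ℕ → Proc n Unit) : ℕ → ℕ → ComparisonTree n
  | _, 0 => .reportDistinct
  | b, N + 1 => (P b).toTree (roundsTree P (b + 1) N)

/-- As the costs of the rounds grow geometrically, the total cost is at most a constant times the
cost of the last round that finds nothing. -/
theorem roundsTree_runtime_le {n D : ℕ} {P : ℕ → Proc n Unit}
    (hP : ∀ b, (P b).depth ≤ D * 2 ^ b) (I : Fin n → ℕ) (b N : ℕ) :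
    (roundsTree P b N).runtime I ≤ D * 2 ^ b ∨
      ∃ b' < b + N, (P b').run I = some () ∧
        (roundsTree P b N).runtime I + D * 2 ^ b ≤ 4 * (D * 2 ^ b') := by
  induction N generalizing b with
  | zero => exact Or.inl (Nat.zero_le _)
  | succ N ih =>
    rw [roundsTree]
    rcases hrun : (P b).run I with _ | ⟨⟩
    · exact Or.inl ((Proc.toTree_of_run_eq_none _ hrun).2.trans (hP b))
    · right
      have h1 := (Proc.toTree_of_run_eq_some (roundsTree P (b + 1) N) hrun).2
      have h2 := hP b
      have h3 : D * 2 ^ (b + 1) = 2 * (D * 2 ^ b) := by rw [pow_succ]; ring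
      rcases ih (b + 1) with h | ⟨b', hb', hrun', h⟩
      · exact ⟨b, by omega, hrun, by omega⟩
      · exact ⟨b', by omega, hrun', by omega⟩

theorem roundsTree_output {n : ℕ} (P : ℕ → Proc n Unit) (I : Fin n → ℕ) (b N : ℕ) :
    IsCorrectAnswer I ((roundsTree P b N).output I) ∨
      (roundsTree P b N).output I = none ∧ ∀ b', b ≤ b' → b' < b + N → (P b').run I = some () := by
  induction N generalizing b with
  | zero => exact Or.inr ⟨rfl, fun b' h1 h2 => by omega⟩
  | succ N ih =>
    rw [roundsTree]
    rcases hrun : (P b).run I with _ | ⟨⟩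
    · exact Or.inl (Proc.toTree_of_run_eq_none _ hrun).1
    · rw [(Proc.toTree_of_run_eq_some (roundsTree P (b + 1) N) hrun).1]
      rcases ih (b + 1) with h | ⟨h, h'⟩
      · exact Or.inl h
      · refine Or.inr ⟨h, fun b' h1 h2 => ?_⟩
        rcases Nat.eq_or_lt_of_le h1 with rfl | h1
        · exact hrun
        · exact h' b' h1 (by omega)

theorem one_le_runtime (A : DistinctnessAlgorithm) {n : ℕ} (hn : 2 ≤ n) {U : Type} [LinearOrder U]
    (I : Fin n → U) : 1 ≤ (A.tree n).runtime I := by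
  have h0 := A.correct n ℕ (fun _ => 0)
  have h1 := A.correct n ℕ (fun u => (u : ℕ))
  rcases hT : A.tree n with _ | ⟨i, j⟩ | ⟨i, j, next⟩
  · rw [hT] at h0
    exact absurd rfl (h0 ⟨0, by omega⟩ ⟨1, by omega⟩ (by simp))
  · rw [hT] at h1
    exact absurd (Fin.ext h1.2) h1.1
  · simp [ComparisonTree.runtime]

theorem duplicateGraph_treeValue_iso {n : ℕ} (I : Fin n → ℕ) :
    Nonempty (duplicateGraph (fun u => (toLex ([], I u) : TreeValue)) ≃g duplicateGraph I) := by
  have : duplicateGraph (fun u => (toLex ([], I u) : TreeValue)) = duplicateGraph I := by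
    ext a b
    simp [duplicateGraph]
  rw [this]
  exact ⟨RelIso.refl _⟩

/-- For long inputs: rounds whose budgets are the powers of two. -/
theorem exists_tree_of_large {n : ℕ} (hn : 64 ≤ n) :
    ∃ T : ComparisonTree n, (∀ I : Fin n → ℕ, IsCorrectAnswer I (T.output I)) ∧
      ∀ (A : DistinctnessAlgorithm) (I : Fin n → ℕ), ∃ I' : Fin n → TreeValue,
        Nonempty (duplicateGraph I' ≃g duplicateGraph I) ∧
        T.runtime I ≤ 27200 * (Nat.log 2 (Nat.log 2 n) + 1) * (A.tree n).runtime I' := by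
  obtain ⟨L, hL⟩ : ∃ L, L = Nat.log 2 n := ⟨_, rfl⟩
  obtain ⟨ℓ, hℓ⟩ : ∃ ℓ, ℓ = Nat.log 2 L + 1 := ⟨_, rfl⟩
  obtain ⟨θ, hθ⟩ : ∃ θ, θ = 4 * n / 2 ^ ℓ := ⟨_, rfl⟩
  rw [← hL, ← hℓ]
  have hL6 : 6 ≤ L := hL ▸ Nat.le_log_of_pow_le (by norm_num) (by norm_num; exact hn)
  have hLn : 2 ^ L ≤ n := hL ▸ Nat.pow_log_le_self 2 (by omega)
  have hnL : n < 2 ^ (L + 1) := hL ▸ Nat.lt_pow_succ_log_self (by norm_num) n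
  have hLℓ : L < 2 ^ ℓ := hℓ ▸ Nat.lt_pow_succ_log_self (by norm_num) L
  have hℓL : 2 ^ ℓ ≤ 2 * L := by
    rw [hℓ, pow_succ, mul_comm]
    exact Nat.mul_le_mul_left _ (Nat.pow_log_le_self 2 (by omega))
  have hnℓ : n ≤ 2 ^ 2 ^ ℓ := hnL.le.trans (Nat.pow_le_pow_right (by norm_num) hLℓ)
  have hLsq : L * L ≤ n := by
    refine le_trans ?_ hLn
    clear * - hL6
    induction L, hL6 using Nat.le_induction with
    | base => norm_num
    | succ L hL ih => rw [pow_succ]; nlinarith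
  have hθℓ : 2 ^ ℓ ≤ θ := by
    rw [hθ, Nat.le_div_iff_mul_le (by positivity)]
    calc 2 ^ ℓ * 2 ^ ℓ ≤ (2 * L) * (2 * L) := Nat.mul_le_mul hℓL hℓL
      _ = 4 * (L * L) := by ring
      _ ≤ 4 * n := by omega
  have hθn : θ * 2 ^ ℓ ≤ 4 * n := hθ ▸ Nat.div_mul_le_self _ _
  have hnθ : n ≤ 8 * θ * 2 ^ ℓ := by
    have h1 : 4 * n < 2 ^ ℓ * (θ + 1) := hθ ▸ Nat.lt_mul_div_succ _ (by positivity)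
    have h2 : 1 ≤ θ := Nat.one_le_two_pow.trans hθℓ
    have h3 : 2 ^ ℓ * 1 ≤ 2 ^ ℓ * θ := Nat.mul_le_mul_left _ h2
    linarith
  choose P hPd hP using fun b =>
    achieves_round (b := b) (hℓ ▸ Nat.le_add_left 1 _) hθℓ hnL.le hLℓ hnθ
  refine ⟨roundsTree P 0 (L + 1 + ℓ + 1), fun I => ?_, fun A I => ?_⟩
  · rcases roundsTree_output P I 0 (L + 1 + ℓ + 1) with h | ⟨h, h'⟩
    · exact h
    · rw [h]
      have hinj := (hP _ I () (h' (L + 1 + ℓ) (Nat.zero_le _) (by omega))).1.injective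
        (by rw [Nat.add_sub_cancel]; exact hnL.le) (Nat.le_add_left _ _) hnℓ
      exact fun i j hij hIij => hij (hinj hIij)
  · have hone := fun I' : Fin n → TreeValue => one_le_runtime A (by omega) I'
    rcases roundsTree_runtime_le hPd I 0 (L + 1 + ℓ + 1) with h | ⟨b, hb, hrun, h⟩
    · refine ⟨fun u => toLex ([], I u), duplicateGraph_treeValue_iso I, ?_⟩
      have h1 := hone fun u => toLex ([], I u)
      refine h.trans (le_trans ?_ (Nat.mul_le_mul_left _ h1))
      rw [pow_zero]
      omega
    · obtain ⟨hpre, hini⟩ := hP b I () hrun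
      obtain ⟨C, hC⟩ : ∃ C, C = 2 ^ b / 100 := ⟨_, rfl⟩
      have hCb : 100 * C ≤ 2 ^ b := by omega
      obtain ⟨I', hI', hCI'⟩ : ∃ I' : Fin n → TreeValue,
          Nonempty (duplicateGraph I' ≃g duplicateGraph I) ∧ C ≤ (A.tree n).runtime I' := by
        by_cases hinj : Function.Injective I
        · refine exists_runtime_ge_of_injective A (d := L - 1) hinj ?_
          have h1 : 2 ^ b ≤ 4 * (n * L) := by
            calc 2 ^ b ≤ 2 ^ (L + 1 + ℓ) := Nat.pow_le_pow_right (by norm_num) (by omega)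
              _ = 2 * 2 ^ L * 2 ^ ℓ := by rw [pow_add, pow_succ]; ring
              _ ≤ 2 * n * (2 * L) := Nat.mul_le_mul (by omega) hℓL
              _ = 4 * (n * L) := by ring
          have h2 : 2 * 2 ^ (L - 1) = 2 ^ L := by
            rw [← pow_succ', Nat.sub_add_cancel (by omega)]
          have h3 : n * (L - 1) ≤ 2 * ((n - 2 ^ (L - 1)) * (L - 1)) := by
            rw [← mul_assoc]
            exact Nat.mul_le_mul_right _ (by omega)
          have h4 : n * L ≤ 2 * (n * (L - 1)) := by
            rw [mul_left_comm]
            exact Nat.mul_le_mul_left _ (by omega)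
          have h5 : 0 < n * L := by positivity
          omega
        · refine exists_runtime_ge_of_packable A hinj fun v hv => ?_
          rcases Nat.lt_or_ge (32 * n) (2 ^ b) with hlt | hge
          · exact packable_of_initialSegmentBound hini hlt hnℓ hθn hCb v hv
          · exact packable_of_prefixBound (by omega) hpre hge hnℓ hCb v hv
      refine ⟨I', hI', ?_⟩
      have h1 := hone I'
      have h2 : 2 ^ b ≤ 200 * (A.tree n).runtime I' := by omega
      calc _ ≤ 4 * (34 * ℓ * 2 ^ b) := by omega
        _ = 136 * ℓ * 2 ^ b := by ring
        _ ≤ 136 * ℓ * (200 * (A.tree n).runtime I') := Nat.mul_le_mul_left _ h2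
        _ = _ := by ring

/-- For every length there is a correct tree that is competitive with every algorithm on every class
of inputs with the same graph. Short inputs are simply sorted. -/
theorem exists_tree (n : ℕ) :
    ∃ T : ComparisonTree n, (∀ I : Fin n → ℕ, IsCorrectAnswer I (T.output I)) ∧
      ∀ (A : DistinctnessAlgorithm) (I : Fin n → ℕ), ∃ I' : Fin n → TreeValue,
        Nonempty (duplicateGraph I' ≃g duplicateGraph I) ∧
        T.runtime I ≤ 27200 * (Nat.log 2 (Nat.log 2 n) + 1) * (A.tree n).runtime I' := by
  rcases Nat.lt_or_ge n 64 with hn | hn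
  swap
  · exact exists_tree_of_large hn
  rcases Nat.lt_or_ge n 2 with hn2 | hn2
  · refine ⟨.reportDistinct, fun I i j hij => absurd (Fin.ext (by omega)) hij, fun A I => ?_⟩
    exact ⟨_, duplicateGraph_treeValue_iso I, by simp [ComparisonTree.runtime]⟩
  · obtain ⟨P, hPd, hP⟩ := achieves_groupCheck 6 (List.finRange n) (List.nodup_finRange n)
    rw [List.length_finRange] at hPd hP
    refine ⟨P.toTree .reportDistinct, fun I => ?_,
      fun A I => ⟨_, duplicateGraph_treeValue_iso I, ?_⟩⟩
    · rcases hrun : P.run I with _ | ⟨⟩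
      · exact (Proc.toTree_of_run_eq_none _ hrun).1
      · rw [(Proc.toTree_of_run_eq_some _ hrun).1]
        have h1 := length_le_cappedSize (List.nodup_finRange n) (hP I () hrun 1 (by omega))
        rw [List.length_finRange] at h1
        exact fun i j hij hIij => hij (injective_of_le_cappedSize_one h1 hIij)
    · have h1 := one_le_runtime A hn2 fun u => (toLex ([], I u) : TreeValue)
      have h2 : (P.toTree .reportDistinct).runtime I ≤ P.depth := by
        rcases hrun : P.run I with _ | ⟨⟩
        · exact (Proc.toTree_of_run_eq_none _ hrun).2
        · exact (Proc.toTree_of_run_eq_some _ hrun).2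
      refine h2.trans (hPd.trans (le_trans ?_ (Nat.mul_le_mul_left _ h1)))
      omega

/-! ### Reduction to natural numbers and conclusion -/

/-- Replacing elements by their ranks does not change the answers to comparisons. -/
theorem exists_nat_cmp_eq {n : ℕ} {U : Type} [LinearOrder U] (I : Fin n → U) :
    ∃ I' : Fin n → ℕ, ∀ i j, cmp (I' i) (I' j) = cmp (I i) (I j) := by
  have hmono : ∀ i j, I i < I j → (Finset.univ.filter (I · < I i)).card <
      (Finset.univ.filter (I · < I j)).card := fun i j hij =>
    Finset.card_lt_card ⟨fun u hu => by
      simp only [Finset.mem_filter, Finset.mem_univ, true_and] at hu ⊢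
      exact hu.trans hij, fun h => by
      have := h (show i ∈ Finset.univ.filter (I · < I j) by simp [hij])
      simp at this⟩
  refine ⟨fun i => (Finset.univ.filter (I · < I i)).card, fun i j => ?_⟩
  rcases lt_trichotomy (I i) (I j) with h | h | h
  · rw [h.cmp_eq_lt, (hmono i j h).cmp_eq_lt]
  · simp only [h, cmp_self_eq_eq]
  · rw [h.cmp_eq_gt, (hmono j i h).cmp_eq_gt]

theorem ComparisonTree.output_runtime_congr {n : ℕ} {U V : Type} [LinearOrder U] [LinearOrder V]
    {I : Fin n → U} {I' : Fin n → V} (h : ∀ i j, cmp (I' i) (I' j) = cmp (I i) (I j))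
    (T : ComparisonTree n) : T.output I' = T.output I ∧ T.runtime I' = T.runtime I := by
  induction T with
  | reportDistinct => exact ⟨rfl, rfl⟩
  | reportPair i j => exact ⟨rfl, rfl⟩
  | compare i j next ih =>
    simp only [ComparisonTree.output, ComparisonTree.runtime, h i j, (ih _).1, (ih _).2, and_self]

theorem log_log_add_one_le (n : ℕ) :
    ((Nat.log 2 (Nat.log 2 n) + 1 : ℕ) : ℝ) ≤ 2 * max 1 (Real.logb 2 (Real.logb 2 n)) := by
  have h1 : (1 : ℝ) ≤ max 1 (Real.logb 2 (Real.logb 2 n)) := le_max_left _ _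
  have h2 : ((Nat.log 2 (Nat.log 2 n) : ℕ) : ℝ) ≤ max 1 (Real.logb 2 (Real.logb 2 n)) := by
    rcases Nat.eq_zero_or_pos (Nat.log 2 n) with h | h
    · rw [h, Nat.log_zero_right, Nat.cast_zero]
      linarith
    · refine le_trans ?_ (le_max_right _ _)
      refine (Real.natLog_le_logb _ _).trans ?_
      rw [Nat.cast_ofNat]
      refine Real.logb_le_logb_of_le (by norm_num) (by exact_mod_cast h) ?_
      exact_mod_cast Real.natLog_le_logb n 2
  push_cast
  linarith

theorem mainTheorem1 :
    ∃ c : ℝ, 0 < c ∧ ∃ A : DistinctnessAlgorithm,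
      ∀ (n : ℕ) (G : SimpleGraph (Fin n)), IsUnionOfCliques G →
        ∀ A' : DistinctnessAlgorithm,
          (universalRuntime A G : ℝ) ≤
            c * max 1 (Real.logb 2 (Real.logb 2 (n : ℝ))) * (universalRuntime A' G : ℝ) := by
  choose T hT hrun using exists_tree
  refine ⟨54400, by norm_num, ⟨T, fun n U _ I => ?_⟩, fun n G hG A' => ?_⟩
  · obtain ⟨I', hI'⟩ := exists_nat_cmp_eq I
    have heq : ∀ i j, I' i = I' j ↔ I i = I j := fun i j => by
      rw [← cmp_eq_eq_iff, hI', cmp_eq_eq_iff]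
    have h1 := hT n I'
    rw [((T n).output_runtime_congr hI').1] at h1
    match (T n).output I, h1 with
    | none, h1 => exact fun i j hij h => h1 i j hij ((heq i j).2 h)
    | some (i, j), h1 => exact ⟨h1.1, (heq i j).1 h1.2⟩
  · obtain ⟨U, _, I, ⟨e⟩, hI⟩ := (universalRuntime_isGreatest _ G hG).1
    obtain ⟨I₀, hI₀⟩ := exists_nat_cmp_eq I
    have hgraph : duplicateGraph I₀ = duplicateGraph I := by
      ext a b
      simp only [duplicateGraph, ← cmp_eq_eq_iff, hI₀]
    obtain ⟨I', ⟨e'⟩, hI'⟩ := hrun n A' I₀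
    rw [((T n).output_runtime_congr hI₀).2] at hI'
    have hle : (A'.tree n).runtime I' ≤ universalRuntime A' G :=
      (universalRuntime_isGreatest A' G hG).2
        ⟨TreeValue, inferInstance, I', ⟨e'.trans (hgraph ▸ e)⟩, rfl⟩
    rw [hI]
    have h1 : (((T n).runtime I : ℕ) : ℝ) ≤
        27200 * ((Nat.log 2 (Nat.log 2 n) + 1 : ℕ) : ℝ) * (universalRuntime A' G : ℝ) := by
      exact_mod_cast hI'.trans (Nat.mul_le_mul_left _ hle)
    refine h1.trans ?_
    have h2 := log_log_add_one_le n
    exact mul_le_mul_of_nonneg_right (by linarith) (Nat.cast_nonneg _)
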